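/- **Theorem 3.2 (Hardy estimate in Fock space).** Let $\mathfrak h = L^2(\mathbb R^3\times\{1,2\})$ (complex-valued functions of $(k,\lambda)$; Lebesgue measure times counting measure) and let $\mathcal F = \mathbb C\oplus\bigoplus_{n\ge 1}\otimes_s^n\mathfrak h$ be the symmetric Fock space over $\mathfrak h$. For an operator $a$ in $\mathfrak h$, let $d\Gamma(a)$ be its second quantization: the closure of the operator in $\mathcal F$ that acts as $\sum_{j=1}^n 1\otimes\cdots\otimes a\otimes\cdots\otimes 1$ ($a$ in the $j$-th factor) on the algebraic symmetric tensor power $\otimes_s^n D(a)$ for every $n$ (and as $0$ for $n=0$). Let $|k|$ be the operator of multiplication by $|k|$ in $\mathfrak h$ and $|i\nabla_k| = \sqrt{-\Delta_k}$, acting on each of the two components $f(\cdot,\lambda)$ of $f \in \mathfrak h$, both on their natural (self-adjointness) domains. Let $\mathcal N$ be the number operator, $(\mathcal N\Phi)^{(n)} = n\,\Phi^{(n)}$. Let $\mathcal V\subset\mathfrak h$ be the space of $f$ with $f(\cdot,1), f(\cdot,2)\in C_0^\infty(\mathbb R^3)$, and let $\Gamma_{\rm fin}(\mathcal V)$ be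 the space of $\Phi=(\Phi^{(0)},\Phi^{(1)},\dots)\in\mathcal F$ such that $\Phi^{(n)}$ belongs to the algebraic symmetric tensor power $\otimes_s^n\mathcal V$ for all $n$ and $\Phi^{(n)}=0$ for all sufficiently large $n$. For every $\rho>0$, the operator $(d\Gamma(|i\nabla_k|)+\rho)^{-1}\mathcal N^2$ is defined on $\Gamma_{\rm fin}(\mathcal V)\subset D(d\Gamma(|k|))$, and it extends by continuity to a bounded operator from $D(d\Gamma(|k|))$, equipped with the graph norm of $d\Gamma(|k|)$, to $\mathcal F$; that is, there is exactly one linear map $D(d\Gamma(|k|))\to\mathcal F$ that is bounded for the graph norm and agrees with $(d\Gamma(|i\nabla_k|)+\rho)^{-1}\mathcal N^2$ on $\Gamma_{\rm fin}(\mathcal V)$. Denoting the extension by the same symbol, one has $$\big\|(d\Gamma(|i\nabla_k|)+\rho)^{-1}\mathcal N^2\Phi\big\|\le 2\,\big\|d\Gamma(|k|)\Phi\big\|\qquad\text{for all }\Phi\in D(d\Gamma(|k|)).$$ -/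

import Mathlib

open MeasureTheory
open scoped ENNReal FourierTransform ContDiff

noncomputable section

namespace HardyFock

/-! ## Operators -/

section Operators

variable {E F G : Type*} [AddCommGroup E] [Module ℂ E] [AddCommGroup F] [Module ℂ F]
  [AddCommGroup G] [Module ℂ G]

/-- The product `B A` of two unbounded operators, with its natural domain
`{x ∈ D(A) | A x ∈ D(B)}`. -/
def opComp (B : F →ₗ.[ℂ] G) (A : E →ₗ.[ℂ] F) : E →ₗ.[ℂ] G :=
  B.comp (A.domRestrict ((B.domain.comap A.toFun).map A.domain.subtype)) fun x => by
    obtain ⟨y, hy, hyx⟩ := x.2.1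
    rw [LinearPMap.domRestrict_apply (y := y) hyx.symm]
    exact hy

/-- `(A + ρ)⁻¹`, with domain the range of `A + ρ`. -/
def invShift (A : E →ₗ.[ℂ] E) (ρ : ℝ) : E →ₗ.[ℂ] E :=
  (((ρ : ℂ) • (LinearMap.id : E →ₗ[ℂ] E)) +ᵥ A).inverse

end Operators

/-! ## The symmetric Fock space over `L²(X, μ)` -/

section Fock

variable {X : Type*} [MeasurableSpace X] (μ : Measure X) [SigmaFinite μ]

theorem measurePreserving_perm {n : ℕ} (σ : Equiv.Perm (Fin n)) :
    MeasurePreserving (fun x : Fin n → X => x ∘ σ)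
      (Measure.pi fun _ : Fin n => μ) (Measure.pi fun _ : Fin n => μ) := by
  have h := measurePreserving_piCongrLeft (fun _ : Fin n => μ) σ.symm
  convert h using 1
  funext x i
  rw [MeasurableEquiv.coe_piCongrLeft, Equiv.piCongrLeft_apply_eq_cast]
  simp

/-- The `n`-particle space `⊗ₛⁿ L²(X, μ)`, realised as the space of the `f ∈ L²(Xⁿ, μⁿ)` with
`f (x_{σ 1}, …, x_{σ n}) = f (x_1, …, x_n)` a.e., for every permutation `σ`. For `n = 0` it is
`L²` of a point of mass one, that is, `ℂ`. -/
def symSector (n : ℕ) : Submodule ℂ (Lp ℂ 2 (Measure.pi fun _ : Fin n => μ)) :=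
  ⨅ σ : Equiv.Perm (Fin n), LinearMap.eqLocus
    (Lp.compMeasurePreservingₗ ℂ (fun x : Fin n → X => x ∘ σ) (measurePreserving_perm μ σ))
    LinearMap.id

/-- The symmetric Fock space `Γ(L²(X, μ)) = ⨁ₙ ⊗ₛⁿ L²(X, μ)` (Hilbert space direct sum). -/
abbrev Fock : Type _ := lp (fun n : ℕ => symSector μ n) 2

variable {μ}

theorem memLp_prod {n : ℕ} (f : Fin n → Lp ℂ 2 μ) :
    MemLp (fun x : Fin n → X => ∏ i, f i (x i)) 2 (Measure.pi fun _ : Fin n => μ) := by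
  have hm : AEStronglyMeasurable (fun x : Fin n → X => ∏ i, f i (x i))
      (Measure.pi fun _ : Fin n => μ) := by
    have : (fun x : Fin n → X => ∏ i, f i (x i)) = ∏ i, fun x : Fin n → X => f i (x i) := by
      funext x; simp
    rw [this]
    refine Finset.aestronglyMeasurable_prod _ fun i _ => ?_
    exact ((Lp.stronglyMeasurable (f i)).comp_measurable (measurable_pi_apply i)).aestronglyMeasurable
  rw [memLp_two_iff_integrable_sq_norm hm]
  simp_rw [norm_prod, ← Finset.prod_pow]
  exact Integrable.fintype_prod (f := fun (i : Fin n) (y : X) => ‖f i y‖ ^ 2) fun i =>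
    (memLp_two_iff_integrable_sq_norm (Lp.aestronglyMeasurable (f i))).1 (Lp.memLp (f i))

/-- The product vector `f₁ ⊗ ⋯ ⊗ fₙ`, that is, the function `∏ i, f i (x i)` in `L²(Xⁿ, μⁿ)`. -/
def tensor {n : ℕ} (f : Fin n → Lp ℂ 2 μ) : Lp ℂ 2 (Measure.pi fun _ : Fin n => μ) :=
  (memLp_prod f).toLp _

theorem comp_tensor {n : ℕ} (f : Fin n → Lp ℂ 2 μ) (σ : Equiv.Perm (Fin n)) :
    Lp.compMeasurePreservingₗ ℂ (fun x : Fin n → X => x ∘ σ) (measurePreserving_perm μ σ)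
      (tensor f) = tensor (fun i => f (σ.symm i)) := by
  change Lp.compMeasurePreserving _ (measurePreserving_perm μ σ) ((memLp_prod f).toLp _) = _
  rw [Lp.toLp_compMeasurePreserving]
  refine MemLp.toLp_congr _ _ (Filter.Eventually.of_forall fun x => ?_)
  simp only [Function.comp_apply]
  exact Fintype.prod_equiv σ _ _ (by simp)

/-- The symmetrized product vector `(n!)⁻¹ ∑_σ f_{σ 1} ⊗ ⋯ ⊗ f_{σ n}` in `⊗ₛⁿ L²(X, μ)`. -/
def symTensor {n : ℕ} (f : Fin n → Lp ℂ 2 μ) : symSector μ n :=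
  ⟨((n.factorial : ℂ)⁻¹) • ∑ σ : Equiv.Perm (Fin n), tensor (fun i => f (σ i)), by
    rw [symSector, Submodule.mem_iInf]
    intro τ
    rw [LinearMap.mem_eqLocus, map_smul, map_sum, LinearMap.id_apply]
    congr 1
    simp_rw [comp_tensor]
    exact Fintype.sum_equiv (Equiv.mulRight τ⁻¹) _ _ (fun σ => rfl)⟩

/-- The graph of the operator `dΓ(A)` on its algebraic domain: the linear span of the symmetrized
product vectors of elements of `D(A)`, on which
`f₁ ⊗ₛ ⋯ ⊗ₛ fₙ ↦ ∑ j, f₁ ⊗ₛ ⋯ ⊗ₛ A fⱼ ⊗ₛ ⋯ ⊗ₛ fₙ` (and `Ω ↦ 0` for `n = 0`). -/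
def dGammaAlgGraph (A : Lp ℂ 2 μ →ₗ.[ℂ] Lp ℂ 2 μ) : Submodule ℂ (Fock μ × Fock μ) :=
  Submodule.span ℂ {p | ∃ (n : ℕ) (f : Fin n → A.domain),
    p.1 = lp.single 2 n (symTensor fun i => (f i : Lp ℂ 2 μ)) ∧
    p.2 = lp.single 2 n (∑ j : Fin n,
      symTensor (Function.update (fun i => (f i : Lp ℂ 2 μ)) j (A (f j))))}

/-- The second quantization `dΓ(A)` of an operator `A` in `L²(X, μ)`: the closure of
`∑ j, 1 ⊗ ⋯ ⊗ A ⊗ ⋯ ⊗ 1` from the finite-particle vectors in the algebraic symmetric tensor powers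
of `D(A)`. -/
def dGamma (A : Lp ℂ 2 μ →ₗ.[ℂ] Lp ℂ 2 μ) : Fock μ →ₗ.[ℂ] Fock μ :=
  (dGammaAlgGraph A).topologicalClosure.toLinearPMap

variable (μ) in
/-- The number operator, `(𝒩 Φ)⁽ⁿ⁾ = n Φ⁽ⁿ⁾`, on its maximal domain. -/
def numberOp : Fock μ →ₗ.[ℂ] Fock μ where
  domain :=
    { carrier := {Φ | Memℓp (fun n : ℕ => (n : ℂ) • Φ n) 2}
      add_mem' := fun {Φ Ψ} h h' => by
        have := Memℓp.add h h'
        simp only [Set.mem_ofPred_eq, lp.coeFn_add, Pi.add_apply, smul_add]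
        exact this
      zero_mem' := by
        simp only [Set.mem_ofPred_eq, lp.coeFn_zero, Pi.zero_apply, smul_zero]
        exact zero_memℓp
      smul_mem' := fun c Φ h => by
        have := Memℓp.const_smul h c
        simp only [Set.mem_ofPred_eq, lp.coeFn_smul, Pi.smul_apply, smul_comm _ c]
        exact this }
  toFun :=
    { toFun := fun Φ => ⟨fun n : ℕ => (n : ℂ) • (Φ : Fock μ) n, Φ.2⟩
      map_add' := fun Φ Ψ => by
        ext1; funext n; exact smul_add _ _ _
      map_smul' := fun c Φ => by
        ext1; funext n; exact smul_comm (n : ℂ) c ((Φ : Fock μ) n) }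

/-- The algebraic symmetric tensor power `⊗ₛⁿ V ⊆ ⊗ₛⁿ L²(X, μ)` of a subspace `V ⊆ L²(X, μ)`. -/
def algSymPower (V : Submodule ℂ (Lp ℂ 2 μ)) (n : ℕ) : Submodule ℂ (symSector μ n) :=
  Submodule.span ℂ {u | ∃ f : Fin n → V, u = symTensor fun i => (f i : Lp ℂ 2 μ)}

/-- `Γ_fin(V)`: the vectors `Φ = (Φ⁽⁰⁾, Φ⁽¹⁾, …)` with `Φ⁽ⁿ⁾` in the algebraic symmetric tensor
power `⊗ₛⁿ V` for all `n`, and `Φ⁽ⁿ⁾ = 0` for all large `n`. -/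
def gammaFin (V : Submodule ℂ (Lp ℂ 2 μ)) : Submodule ℂ (Fock μ) where
  carrier := {Φ | (∀ n, Φ n ∈ algSymPower V n) ∧ ∃ n₀ : ℕ, ∀ n ≥ n₀, Φ n = 0}
  add_mem' := by
    rintro Φ Ψ ⟨h, n₀, hn⟩ ⟨h', m₀, hm⟩
    refine ⟨fun n => (algSymPower V n).add_mem (h n) (h' n), max n₀ m₀, fun n hnm => ?_⟩
    rw [lp.coeFn_add, Pi.add_apply, hn n (le_trans (le_max_left _ _) hnm),
      hm n (le_trans (le_max_right _ _) hnm), add_zero]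
  zero_mem' := ⟨fun n => (algSymPower V n).zero_mem, 0, fun n _ => rfl⟩
  smul_mem' := by
    rintro c Φ ⟨h, n₀, hn⟩
    refine ⟨fun n => (algSymPower V n).smul_mem c (h n), n₀, fun n hnm => ?_⟩
    rw [lp.coeFn_smul, Pi.smul_apply, hn n hnm, smul_zero]

/-- Multiplication by `w` in `L²(X, μ)`, on its maximal domain. -/
def mulOp (μ : Measure X) (w : X → ℂ) : Lp ℂ 2 μ →ₗ.[ℂ] Lp ℂ 2 μ where
  domain :=
    { carrier := {f | MemLp (fun x => w x * f x) 2 μ}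
      add_mem' := fun {f g} hf hg => by
        refine (MemLp.add hf hg).ae_eq ?_
        filter_upwards [Lp.coeFn_add f g] with x hx
        rw [Pi.add_apply] at hx ⊢
        rw [hx, mul_add]
      zero_mem' := by
        refine (MemLp.zero (p := 2) (μ := μ) (ε := ℂ)).ae_eq ?_
        filter_upwards [Lp.coeFn_zero ℂ 2 μ] with x hx
        rw [hx]; simp
      smul_mem' := fun c f hf => by
        refine (MemLp.const_smul hf c).ae_eq ?_
        filter_upwards [Lp.coeFn_smul c f] with x hx
        simp [hx, mul_left_comm] }
  toFun :=
    { toFun := fun f => MemLp.toLp (fun x => w x * (f : Lp ℂ 2 μ) x) f.2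
      map_add' := fun f g => by
        rw [← MemLp.toLp_add]
        refine MemLp.toLp_congr _ _ ?_
        filter_upwards [Lp.coeFn_add (f : Lp ℂ 2 μ) g] with x hx
        rw [Pi.add_apply] at hx ⊢
        exact (congrArg (w x * ·) hx).trans (mul_add _ _ _)
      map_smul' := fun c f => by
        rw [RingHom.id_apply, ← MemLp.toLp_const_smul]
        refine MemLp.toLp_congr _ _ ?_
        filter_upwards [Lp.coeFn_smul c (f : Lp ℂ 2 μ)] with x hx
        simp [hx, mul_left_comm] }

end Fock

/-! ## The photon one-particle space -/

/-- Momentum space `ℝ³`. -/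
abbrev R3 : Type := EuclideanSpace ℝ (Fin 3)

/-- The measure on `ℝ³ × {1, 2}`: Lebesgue measure times counting measure. -/
abbrev photonMeasure : Measure (R3 × Fin 2) := (volume : Measure R3).prod Measure.count

/-- The one-photon space `L²(ℝ³ × {1, 2})`. -/
abbrev OnePhoton : Type := Lp ℂ 2 photonMeasure

theorem map_pair_le (l : Fin 2) :
    (volume : Measure R3).map (fun k => (k, l)) ≤ photonMeasure := by
  refine Measure.le_iff.2 fun s hs => ?_
  have hm : Measurable fun k : R3 => (k, l) := by fun_prop
  rw [Measure.map_apply hm hs, Measure.prod_apply_symm hs, lintegral_count, tsum_fintype]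
  exact Finset.single_le_sum (f := fun y : Fin 2 => volume ((fun k : R3 => (k, y)) ⁻¹' s))
    (fun _ _ => zero_le) (Finset.mem_univ l)

theorem ae_slice {P : R3 × Fin 2 → Prop} (h : ∀ᵐ p ∂photonMeasure, P p) (l : Fin 2) :
    ∀ᵐ k : R3, P (k, l) :=
  ae_of_ae_map (f := fun k : R3 => (k, l)) (by fun_prop)
    ((Measure.absolutelyContinuous_of_le (map_pair_le l)).ae_le h)

theorem memLp_slice (f : OnePhoton) (l : Fin 2) : MemLp (fun k : R3 => f (k, l)) 2 volume :=
  ((Lp.memLp f).mono_measure (map_pair_le l)).comp_of_map (by fun_prop)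

/-- The polarization component `f(·, l) ∈ L²(ℝ³)` of a one-photon vector. -/
def component (l : Fin 2) : OnePhoton →ₗ[ℂ] Lp ℂ 2 (volume : Measure R3) where
  toFun f := (memLp_slice f l).toLp _
  map_add' f g := by
    rw [← MemLp.toLp_add]
    exact MemLp.toLp_congr _ _ (ae_slice (Lp.coeFn_add f g) l)
  map_smul' c f := by
    rw [RingHom.id_apply, ← MemLp.toLp_const_smul]
    exact MemLp.toLp_congr _ _ (ae_slice (Lp.coeFn_smul c f) l)

/-- The operator `|k|` of multiplication by the photon energy in `L²(ℝ³ × {1, 2})`. -/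
def absK : OnePhoton →ₗ.[ℂ] OnePhoton :=
  mulOp photonMeasure fun p => ((‖p.1‖ : ℝ) : ℂ)

/-- The graph of `|i∇_k| = √(-Δ_k)` in `L²(ℝ³ × {1, 2})`: the pairs `(f, g)` with
`𝓕 g(·, l) (ξ) = 2π|ξ| 𝓕 f(·, l) (ξ)` for `l = 1, 2`, where `𝓕` is the unitary Fourier transform
with kernel `exp (-2πi k·ξ)`. -/
def absGradGraph : Submodule ℂ (OnePhoton × OnePhoton) where
  carrier := {p | ∀ l : Fin 2,
    (𝓕 (component l p.2) : Lp ℂ 2 (volume : Measure R3)) =ᵐ[volume]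
      fun ξ => ((2 * Real.pi * ‖ξ‖ : ℝ) : ℂ) *
        (𝓕 (component l p.1) : Lp ℂ 2 (volume : Measure R3)) ξ}
  add_mem' := by
    intro p q hp hq l
    have h1 : (𝓕 (component l (p + q).1) : Lp ℂ 2 (volume : Measure R3))
        = 𝓕 (component l p.1) + 𝓕 (component l q.1) := by
      rw [Prod.fst_add, map_add, FourierTransform.fourier_add]
    have h2 : (𝓕 (component l (p + q).2) : Lp ℂ 2 (volume : Measure R3))
        = 𝓕 (component l p.2) + 𝓕 (component l q.2) := by
      rw [Prod.snd_add, map_add, FourierTransform.fourier_add]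
    rw [h1, h2]
    filter_upwards [hp l, hq l, Lp.coeFn_add (𝓕 (component l p.1)) (𝓕 (component l q.1)),
      Lp.coeFn_add (𝓕 (component l p.2)) (𝓕 (component l q.2))] with ξ a b c d
    rw [c, d, Pi.add_apply, Pi.add_apply, a, b, mul_add]
  zero_mem' := by
    intro l
    have h : (𝓕 (component l 0) : Lp ℂ 2 (volume : Measure R3)) = 0 := by
      rw [map_zero, FourierTransform.fourier_zero]
    simp only [Prod.fst_zero, Prod.snd_zero, h]
    filter_upwards [Lp.coeFn_zero ℂ 2 (volume : Measure R3)] with ξ a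
    rw [a]; simp
  smul_mem' := by
    intro c p hp l
    have h1 : (𝓕 (component l (c • p).1) : Lp ℂ 2 (volume : Measure R3))
        = c • 𝓕 (component l p.1) := by
      rw [Prod.smul_fst, map_smul, FourierTransform.fourier_smul]
    have h2 : (𝓕 (component l (c • p).2) : Lp ℂ 2 (volume : Measure R3))
        = c • 𝓕 (component l p.2) := by
      rw [Prod.smul_snd, map_smul, FourierTransform.fourier_smul]
    rw [h1, h2]
    filter_upwards [hp l, Lp.coeFn_smul c (𝓕 (component l p.1)),
      Lp.coeFn_smul c (𝓕 (component l p.2))] with ξ a b d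
    rw [b, d, Pi.smul_apply, Pi.smul_apply, a, smul_eq_mul, smul_eq_mul, mul_left_comm]

/-- The operator `|i∇_k|` in `L²(ℝ³ × {1, 2})`, on its maximal domain. -/
def absGrad : OnePhoton →ₗ.[ℂ] OnePhoton := absGradGraph.toLinearPMap

/-- The subspace of `L²(ℝ³ × {1, 2})` of (classes of) functions `f` such that `f(·, 1)` and
`f(·, 2)` are smooth functions with compact support on `ℝ³`. -/
def testFunctions : Submodule ℂ OnePhoton where
  carrier := {f | ∃ φ : Fin 2 → R3 → ℂ, (∀ l, ContDiff ℝ ∞ (φ l) ∧ HasCompactSupport (φ l)) ∧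
    f =ᵐ[photonMeasure] fun p => φ p.2 p.1}
  add_mem' := by
    rintro f g ⟨φ, hφ, hf⟩ ⟨ψ, hψ, hg⟩
    refine ⟨φ + ψ, fun l => ⟨(hφ l).1.add (hψ l).1, (hφ l).2.add (hψ l).2⟩, ?_⟩
    filter_upwards [hf, hg, Lp.coeFn_add f g] with p a b c
    rw [c, Pi.add_apply, a, b]; rfl
  zero_mem' := by
    refine ⟨0, fun l => ⟨contDiff_const, HasCompactSupport.zero⟩, ?_⟩
    filter_upwards [Lp.coeFn_zero ℂ 2 photonMeasure] with p a
    rw [a]; rfl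
  smul_mem' := by
    rintro c f ⟨φ, hφ, hf⟩
    refine ⟨fun l k => c * φ l k, fun l => ⟨contDiff_const.mul (hφ l).1, (hφ l).2.mul_left⟩, ?_⟩
    filter_upwards [hf, Lp.coeFn_smul c f] with p a b
    rw [b, Pi.smul_apply, a, smul_eq_mul]

/-- The operator `(dΓ(|i∇_k|) + ρ)⁻¹ 𝒩²` with its natural domain. -/
def hardyOp (ρ : ℝ) : Fock photonMeasure →ₗ.[ℂ] Fock photonMeasure :=
  opComp (invShift (dGamma absGrad) ρ) (opComp (numberOp photonMeasure) (numberOp photonMeasure))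

/-- `T` is a bounded operator on `D(A)` equipped with the graph norm `‖Φ‖ + ‖A Φ‖`. -/
def IsBoundedOnDomain {E : Type*} [NormedAddCommGroup E] [NormedSpace ℂ E] (A : E →ₗ.[ℂ] E)
    (T : A.domain →ₗ[ℂ] E) : Prop :=
  ∃ C : ℝ, ∀ Φ : A.domain, ‖T Φ‖ ≤ C * (‖(Φ : E)‖ + ‖A Φ‖)

/-- `T` is a bounded operator on `D(A)` (with the graph norm) that extends the restriction of the
operator `S` to the subspace `V`. -/
def IsBoundedExtension {E : Type*} [NormedAddCommGroup E] [NormedSpace ℂ E] (A S : E →ₗ.[ℂ] E)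
    (V : Submodule ℂ E) (T : A.domain →ₗ[ℂ] E) : Prop :=
  IsBoundedOnDomain A T ∧
    ∀ (Φ : A.domain) (Ψ : S.domain), (Φ : E) = Ψ → (Φ : E) ∈ V → T Φ = S Ψ

end HardyFock

end

noncomputable section

namespace HardyFock

/-! ### Bounded multiplication operators -/

section BoundedMul

variable {X : Type*} [MeasurableSpace X] {μ : Measure X}

/-! Everything is decided in one `n`-particle sector at a time. After a Fourier transform in every
variable, `(dΓ(|i∇|) + ρ)⁻¹ 𝒩²` is multiplication by `n² / (∑ⱼ 2π|ξⱼ| + ρ)`. Spreading `ρ` evenly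
over the particles, Cauchy–Schwarz bounds this by `∑ⱼ (2π|ξⱼ| + ρ/n)⁻¹`, hence by `∑ⱼ a(ξⱼ)` with
the bounded symbol `a(ξ) = (2π √(|ξ|² + ε))⁻¹`, `ε = (ρ/(2πn))²` (`sq_div_le_sum`,
`inv_hardyMultiplier_le`). It remains to show `‖∑ⱼ aⱼ Φ‖ ≤ 2 ‖∑ⱼ |kⱼ| Φ‖`, where `aⱼ` is the
operator with symbol `a` acting on particle `j`.

For one particle this is Hardy's inequality `‖a f‖ ≤ 2 ‖|k| f‖`, with the roles of position and
momentum exchanged (`hardy_schwartz`, `norm_hardyMultiplier_mul_le`). In operator terms `a² ≤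
4|k|²`, and taking square roots gives `a ≤ 2|k|` as forms (`re_inner_le_of_norm_le`). Expanding the
two squares, the diagonal terms are compared by the first inequality, while an off-diagonal term `aᵢ
aⱼ` is dominated by `4 |kᵢ| |kⱼ|` because tensor products of ordered positive operators are ordered.
On finite sums of product vectors that last fact is the Schur product theorem for Gram matrices
(`posSemidef_prod_sub_prod`, `norm_sum_tensor_update_le`).

Second quantizations are defined as closures, so their concrete form has to be proved: if a unitary
turns `A` into multiplication by `w`, its tensor powers turn `dΓ(A)` into multiplication by `∑ⱼ
w(xⱼ)` (`IsDiagonalizedBy.ae_of_mem_closure`, `IsDiagonalizedBy.mem_closure_of_ae`). This yields the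
resolvent and its domain. Uniqueness of the extension holds because finite sums of products of test
functions form a core for `dΓ(|k|)` (`dGammaAlgGraph_le_closure_core`). -/

theorem memLp_bounded_mul {m : X → ℂ} (hm : Measurable m) {C : ℝ} (hC : ∀ x, ‖m x‖ ≤ C)
    (f : Lp ℂ 2 μ) : MemLp (fun x => m x * f x) 2 μ :=
  (Lp.memLp f).of_le_mul (c := C)
    (hm.aestronglyMeasurable.mul (Lp.aestronglyMeasurable f)) (Filter.Eventually.of_forall fun x => by
      rw [norm_mul]; exact mul_le_mul_of_nonneg_right (hC x) (norm_nonneg _))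

/-- Multiplication by a bounded measurable function, as a bounded operator in `L²(X, μ)`. -/
def boundedMul (μ : Measure X) {m : X → ℂ} (hm : Measurable m) {C : ℝ} (hC : ∀ x, ‖m x‖ ≤ C) :
    Lp ℂ 2 μ →L[ℂ] Lp ℂ 2 μ :=
  LinearMap.mkContinuous
    { toFun := fun f => (memLp_bounded_mul hm hC f).toLp _
      map_add' := fun f g => by
        rw [← MemLp.toLp_add]
        refine MemLp.toLp_congr _ _ ?_
        filter_upwards [Lp.coeFn_add f g] with x hx
        rw [hx, Pi.add_apply, Pi.add_apply, mul_add]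
      map_smul' := fun c f => by
        rw [RingHom.id_apply, ← MemLp.toLp_const_smul]
        refine MemLp.toLp_congr _ _ ?_
        filter_upwards [Lp.coeFn_smul c f] with x hx
        simp [hx, mul_left_comm] } C fun f => by
    refine Lp.norm_le_mul_norm_of_ae_le_mul ?_
    filter_upwards [(memLp_bounded_mul hm hC f).coeFn_toLp] with x hx
    change ‖((memLp_bounded_mul hm hC f).toLp _ : Lp ℂ 2 μ) x‖ ≤ _
    rw [hx, norm_mul]
    exact mul_le_mul_of_nonneg_right (hC x) (norm_nonneg _)

theorem boundedMul_ae {m : X → ℂ} (hm : Measurable m) {C : ℝ} (hC : ∀ x, ‖m x‖ ≤ C)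
    (f : Lp ℂ 2 μ) : boundedMul μ hm hC f =ᵐ[μ] fun x => m x * f x :=
  (memLp_bounded_mul hm hC f).coeFn_toLp

theorem norm_boundedMul_apply_le {m : X → ℂ} (hm : Measurable m) {C : ℝ} (hC : ∀ x, ‖m x‖ ≤ C)
    (f : Lp ℂ 2 μ) : ‖boundedMul μ hm hC f‖ ≤ C * ‖f‖ := by
  refine Lp.norm_le_mul_norm_of_ae_le_mul ?_
  filter_upwards [boundedMul_ae hm hC f] with x hx
  rw [hx, norm_mul]
  exact mul_le_mul_of_nonneg_right (hC x) (norm_nonneg _)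

end BoundedMul

/-! ### Product vectors: inner products, density, tensor powers of unitaries -/

section Tensor

variable {X : Type*} [MeasurableSpace X] {μ : Measure X} [SigmaFinite μ] {n : ℕ}

theorem ae_eval {P : X → Prop} (h : ∀ᵐ x ∂μ, P x) (i : Fin n) :
    ∀ᵐ x ∂Measure.pi fun _ : Fin n => μ, P (x i) :=
  (Measure.tendsto_eval_ae_ae (μ := fun _ : Fin n => μ) (i := i)).eventually h

theorem ae_eval_all {P : Fin n → X → Prop} (h : ∀ i, ∀ᵐ x ∂μ, P i x) :
    ∀ᵐ x ∂Measure.pi fun _ : Fin n => μ, ∀ i, P i (x i) :=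
  ae_all_iff.2 fun i => ae_eval (h i) i

theorem tensor_ae (f : Fin n → Lp ℂ 2 μ) :
    tensor f =ᵐ[Measure.pi fun _ : Fin n => μ] fun x => ∏ i, f i (x i) :=
  (memLp_prod f).coeFn_toLp

theorem tensor_ae_of_ae {f : Fin n → Lp ℂ 2 μ} {φ : Fin n → X → ℂ} (h : ∀ i, f i =ᵐ[μ] φ i) :
    tensor f =ᵐ[Measure.pi fun _ : Fin n => μ] fun x => ∏ i, φ i (x i) := by
  filter_upwards [tensor_ae f, ae_eval_all h] with x h1 h2
  rw [h1]
  exact Finset.prod_congr rfl fun i _ => h2 i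

theorem inner_tensor (f g : Fin n → Lp ℂ 2 μ) :
    inner ℂ (tensor f) (tensor g) = ∏ i, inner ℂ (f i) (g i) := by
  simp_rw [L2.inner_def]
  rw [← integral_fintype_prod_eq_prod]
  refine integral_congr_ae ?_
  filter_upwards [tensor_ae f, tensor_ae g] with x h1 h2
  simp [h1, h2, Finset.prod_mul_distrib]

theorem norm_tensor (f : Fin n → Lp ℂ 2 μ) : ‖tensor f‖ = ∏ i, ‖f i‖ := by
  have h := inner_tensor f f
  simp_rw [inner_self_eq_norm_sq_to_K, Finset.prod_pow] at h
  have h2 : (‖tensor f‖ : ℝ) ^ 2 = (∏ i, ‖f i‖) ^ 2 := by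
    have := congrArg Complex.re h
    norm_cast at this
  exact (sq_eq_sq₀ (norm_nonneg _) (Finset.prod_nonneg fun _ _ => norm_nonneg _)).1 h2

theorem update_ae (f : Fin n → Lp ℂ 2 μ) (j : Fin n) (u : Lp ℂ 2 μ) :
    tensor (Function.update f j u) =ᵐ[Measure.pi fun _ : Fin n => μ]
      fun x => u (x j) * ∏ i ∈ Finset.univ.erase j, f i (x i) := by
  filter_upwards [tensor_ae (Function.update f j u)] with x hx
  rw [hx, ← Finset.mul_prod_erase Finset.univ _ (Finset.mem_univ j), Function.update_self]
  congr 1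
  refine Finset.prod_congr rfl fun i hi => ?_
  rw [Function.update_of_ne (Finset.ne_of_mem_erase hi)]

variable (μ n) in
/-- The tensor product as a continuous multilinear map. -/
def tensorMap : ContinuousMultilinearMap ℂ (fun _ : Fin n => Lp ℂ 2 μ)
    (Lp ℂ 2 (Measure.pi fun _ : Fin n => μ)) :=
  MultilinearMap.mkContinuous
    (MultilinearMap.mk' tensor
      (fun f j u v => by
        refine Lp.ext ?_
        filter_upwards [update_ae f j (u + v), update_ae f j u, update_ae f j v,
          ae_eval (Lp.coeFn_add u v) j, Lp.coeFn_add (tensor (Function.update f j u))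
            (tensor (Function.update f j v))] with x h1 h2 h3 h4 h5
        rw [h1, h5, Pi.add_apply, h2, h3, h4, Pi.add_apply, add_mul])
      (fun f j c u => by
        refine Lp.ext ?_
        filter_upwards [update_ae f j (c • u), update_ae f j u,
          ae_eval (Lp.coeFn_smul c u) j, Lp.coeFn_smul c (tensor (Function.update f j u))]
          with x h1 h2 h4 h5
        rw [h1, h5, Pi.smul_apply, h2, h4, Pi.smul_apply, smul_eq_mul, smul_eq_mul, mul_assoc]))
    1 (fun f => by rw [one_mul]; exact (norm_tensor f).le)

@[simp]
theorem tensorMap_apply (f : Fin n → Lp ℂ 2 μ) : tensorMap μ n f = tensor f := rfl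

/-- The indicator of a box is itself a product vector, so the integral over the box is an inner
product with a product vector. -/
theorem setIntegral_eq_zero_of_mem_orthogonal
    {G : Lp ℂ 2 (Measure.pi fun _ : Fin n => μ)}
    (hG : G ∈ (Submodule.span ℂ (Set.range (tensor (μ := μ) (n := n))))ᗮ)
    {s : Fin n → Set X} (hs : ∀ i, MeasurableSet (s i)) (hμs : ∀ i, μ (s i) ≠ ⊤) :
    ∫ x in Set.univ.pi s, G x ∂(Measure.pi fun _ : Fin n => μ) = 0 := by
  have hm : MeasurableSet (Set.univ.pi s) := MeasurableSet.univ_pi hs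
  have hμ : Measure.pi (fun _ : Fin n => μ) (Set.univ.pi s) ≠ ⊤ := by
    rw [Measure.pi_pi]
    exact ENNReal.prod_ne_top fun i _ => hμs i
  have h := (Submodule.mem_orthogonal _ _).1 hG
    (tensor fun i => indicatorConstLp 2 (hs i) (hμs i) (1 : ℂ))
    (Submodule.subset_span ⟨_, rfl⟩)
  rw [← L2.inner_indicatorConstLp_one hm hμ, ← h]
  congr 1
  refine Lp.ext ?_
  filter_upwards [indicatorConstLp_coeFn (p := 2) (hs := hm) (hμs := hμ) (c := (1 : ℂ)),
    tensor_ae_of_ae fun i => indicatorConstLp_coeFn (p := 2) (hs := hs i) (hμs := hμs i)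
      (c := (1 : ℂ))] with x h1 h2
  rw [h1, h2]
  by_cases hx : x ∈ Set.univ.pi s
  · rw [Set.indicator_of_mem hx, Finset.prod_eq_one]
    intro i _
    rw [Set.indicator_of_mem (hx i trivial)]
  · rw [Set.indicator_of_notMem hx]
    simp only [Set.mem_pi, Set.mem_univ, true_imp_iff, not_forall] at hx
    obtain ⟨i, hi⟩ := hx
    rw [Finset.prod_eq_zero (Finset.mem_univ i)]
    rw [Set.indicator_of_notMem hi]

variable (μ n) in
-- A `G` orthogonal to all product vectors integrates to zero over boxes with sides of finite
-- measure. Boxes form a π-system generating the product σ-algebra, so a π-λ argument inside each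
-- exhausting box `B k`, followed by `k → ∞`, kills every set integral of finite measure.
theorem dense_span_tensor :
    Dense (Submodule.span ℂ (Set.range (tensor (μ := μ) (n := n))) :
      Set (Lp ℂ 2 (Measure.pi fun _ : Fin n => μ))) := by
  rw [Submodule.dense_iff_topologicalClosure_eq_top, Submodule.topologicalClosure_eq_top_iff,
    Submodule.eq_bot_iff]
  intro G hG
  let ν := Measure.pi fun _ : Fin n => μ
  let B : ℕ → Set (Fin n → X) := fun k => Set.univ.pi fun _ => spanningSets μ k
  have hBm : ∀ k, MeasurableSet (B k) := fun k =>
    MeasurableSet.univ_pi fun _ => measurableSet_spanningSets μ k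
  have hBfin : ∀ k, ν (B k) < ⊤ := fun k => by
    rw [Measure.pi_pi]
    exact (ENNReal.prod_ne_top fun i _ => (measure_spanningSets_lt_top μ k).ne).lt_top
  have hint : ∀ s, ν s ≠ ⊤ → IntegrableOn G s ν := fun s hs =>
    integrableOn_Lp_of_measure_ne_top G fact_one_le_two_ennreal.elim hs
  have hintB : ∀ k s, IntegrableOn G (s ∩ B k) ν := fun k s =>
    (hint _ (hBfin k).ne).mono_set Set.inter_subset_right
  have key : ∀ k s, MeasurableSet s → ∫ x in s ∩ B k, G x ∂ν = 0 := by
    intro k s hs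
    refine MeasurableSpace.induction_on_inter (C := fun s _ => ∫ x in s ∩ B k, G x ∂ν = 0)
      generateFrom_pi.symm isPiSystem_pi (by simp) ?_ ?_ ?_ s hs
    · rintro _ ⟨s, hs, rfl⟩
      rw [← Set.pi_inter_distrib]
      refine setIntegral_eq_zero_of_mem_orthogonal hG
        (fun i => (hs i trivial).inter (measurableSet_spanningSets μ k)) fun i => ?_
      exact ((measure_mono Set.inter_subset_right).trans_lt (measure_spanningSets_lt_top μ k)).ne
    · intro t ht ih
      have h1 := integral_inter_add_sdiff (μ := ν) ht (hint _ (hBfin k).ne)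
      rw [Set.inter_comm, ih, zero_add] at h1
      rw [Set.inter_comm, ← Set.sdiff_eq, h1]
      exact setIntegral_eq_zero_of_mem_orthogonal hG
        (fun i => measurableSet_spanningSets μ k) fun i => (measure_spanningSets_lt_top μ k).ne
    · intro t hd hm ih
      rw [Set.iUnion_inter, integral_iUnion (fun i => (hm i).inter (hBm k))
        (fun i j hij => (hd hij).mono Set.inter_subset_left Set.inter_subset_left)]
      · simp [ih]
      · rw [← Set.iUnion_inter]
        exact hintB k _
  rw [Lp.eq_zero_iff_ae_eq_zero]
  refine Lp.ae_eq_zero_of_forall_setIntegral_eq_zero G two_ne_zero ENNReal.ofNat_ne_top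
    (fun s hs h => hint s h.ne) fun s hs hfin => ?_
  have hU : ⋃ k, s ∩ B k = s := by
    rw [← Set.inter_iUnion, Set.inter_eq_left]
    intro x _
    obtain ⟨k, hk⟩ : ∃ k, ∀ i, x i ∈ spanningSets μ k := by
      choose N hN using fun i => Set.mem_iUnion.1
        ((iUnion_spanningSets μ).symm ▸ Set.mem_univ (x i) : x i ∈ ⋃ k, spanningSets μ k)
      exact ⟨Finset.univ.sup N, fun i =>
        monotone_spanningSets μ (Finset.le_sup (Finset.mem_univ i)) (hN i)⟩
    exact Set.mem_iUnion.2 ⟨k, fun i _ => hk i⟩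
  have ht := tendsto_setIntegral_of_monotone (μ := ν) (f := G) (s := fun k => s ∩ B k)
    (fun k => hs.inter (hBm k))
    (fun k l hkl => Set.inter_subset_inter_right _
      (Set.pi_mono fun _ _ => monotone_spanningSets μ hkl))
    (by rw [hU]; exact hint s hfin.ne)
  rw [hU] at ht
  simp_rw [fun k => key k s hs] at ht
  exact (tendsto_nhds_unique ht tendsto_const_nhds)

variable (μ n) in
theorem denseRange_linearCombination_tensor :
    DenseRange (Finsupp.linearCombination ℂ (tensor (μ := μ) (n := n))) := by
  have := dense_span_tensor μ n
  rwa [← Finsupp.range_linearCombination, LinearMap.coe_range] at this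

/-- The norm of a linear combination depends only on the coefficients and the Gram matrix. This lets
`tensorPower` be defined on formal combinations of product vectors without checking by hand that
linear relations are respected. -/
theorem norm_linearCombination_eq_of_inner_eq {ι H K : Type*} [NormedAddCommGroup H]
    [InnerProductSpace ℂ H] [NormedAddCommGroup K] [InnerProductSpace ℂ K] {v : ι → H} {w : ι → K}
    (h : ∀ i j, inner ℂ (v i) (v j) = inner ℂ (w i) (w j)) (c : ι →₀ ℂ) :
    ‖Finsupp.linearCombination ℂ v c‖ = ‖Finsupp.linearCombination ℂ w c‖ := by
  rw [← sq_eq_sq₀ (norm_nonneg _) (norm_nonneg _), ← inner_self_eq_norm_sq (𝕜 := ℂ),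
    ← inner_self_eq_norm_sq (𝕜 := ℂ)]
  simp only [Finsupp.linearCombination_apply, Finsupp.sum, sum_inner, inner_sum, inner_smul_left,
    inner_smul_right, h]

variable (n) in
/-- The tensor power `U ⊗ ⋯ ⊗ U` of a unitary operator in `L²(X, μ)`. -/
def tensorPower (U : Lp ℂ 2 μ ≃ₗᵢ[ℂ] Lp ℂ 2 μ) :
    Lp ℂ 2 (Measure.pi fun _ : Fin n => μ) ≃ₗᵢ[ℂ] Lp ℂ 2 (Measure.pi fun _ : Fin n => μ) :=
  (Finsupp.domLCongr (Equiv.piCongrRight fun _ : Fin n => U.toEquiv) :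
    ((Fin n → Lp ℂ 2 μ) →₀ ℂ) ≃ₗ[ℂ] _).extendOfIsometry
      (Finsupp.linearCombination ℂ tensor) (Finsupp.linearCombination ℂ tensor)
      (denseRange_linearCombination_tensor μ n) (denseRange_linearCombination_tensor μ n) fun c => by
    rw [Finsupp.domLCongr_apply, Finsupp.domCongr_apply, Finsupp.linearCombination_equivMapDomain]
    refine norm_linearCombination_eq_of_inner_eq (fun f g => ?_) c
    simp [inner_tensor]

theorem tensorPower_tensor (U : Lp ℂ 2 μ ≃ₗᵢ[ℂ] Lp ℂ 2 μ) (f : Fin n → Lp ℂ 2 μ) :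
    tensorPower n U (tensor f) = tensor fun i => U (f i) := by
  have h := LinearEquiv.extendOfIsometry_eq
    (Finsupp.domLCongr (Equiv.piCongrRight fun _ : Fin n => U.toEquiv) :
      ((Fin n → Lp ℂ 2 μ) →₀ ℂ) ≃ₗ[ℂ] _)
    (Finsupp.linearCombination ℂ (tensor (μ := μ) (n := n)))
    (Finsupp.linearCombination ℂ (tensor (μ := μ) (n := n)))
  rw [show tensor f = Finsupp.linearCombination ℂ (tensor (μ := μ) (n := n))
    (Finsupp.single f 1) by simp, tensorPower, h]
  simp
  rfl

theorem tensorPower_symm_tensor (U : Lp ℂ 2 μ ≃ₗᵢ[ℂ] Lp ℂ 2 μ) (f : Fin n → Lp ℂ 2 μ) :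
    (tensorPower n U).symm (tensor f) = tensor fun i => U.symm (f i) := by
  rw [LinearIsometryEquiv.symm_apply_eq, tensorPower_tensor]
  simp

end Tensor

/-! ### Unbounded multiplication operators and cutoffs -/

section MulOp

variable {X : Type*} [MeasurableSpace X] {μ : Measure X}

theorem mem_mulOp_graph {w : X → ℂ} {p : Lp ℂ 2 μ × Lp ℂ 2 μ} :
    p ∈ (mulOp μ w).graph ↔ p.2 =ᵐ[μ] fun x => w x * p.1 x := by
  rw [LinearPMap.mem_graph_iff]
  constructor
  · rintro ⟨y, h1, h2⟩
    rw [← h2, ← h1]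
    exact MemLp.coeFn_toLp y.2
  · intro h
    have hp : MemLp (fun x => w x * p.1 x) 2 μ := (Lp.memLp p.2).ae_eq h
    refine ⟨⟨p.1, hp⟩, rfl, Lp.ext ?_⟩
    exact (MemLp.coeFn_toLp hp).trans h.symm

/-- Dividing the graph equation by `1 + ‖w‖` turns it into an equality of two bounded operators, a
closed condition. -/
theorem isClosed_mulOp_graph {w : X → ℂ} (hw : Measurable w) :
    IsClosed ((mulOp μ w).graph : Set (Lp ℂ 2 μ × Lp ℂ 2 μ)) := by
  have hpos : ∀ x, 0 < 1 + ‖w x‖ := fun x => by positivity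
  have hm : Measurable fun x => ((1 + ‖w x‖ : ℝ) : ℂ)⁻¹ := by fun_prop
  have hm1 : ∀ x, ‖((1 + ‖w x‖ : ℝ) : ℂ)⁻¹‖ ≤ 1 := fun x => by
    rw [norm_inv, Complex.norm_real, Real.norm_of_nonneg (hpos x).le]
    exact inv_le_one_of_one_le₀ (by linarith [norm_nonneg (w x)])
  have hm' : Measurable fun x => ((1 + ‖w x‖ : ℝ) : ℂ)⁻¹ * w x := hm.mul hw
  have hm1' : ∀ x, ‖((1 + ‖w x‖ : ℝ) : ℂ)⁻¹ * w x‖ ≤ 1 := fun x => by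
    rw [norm_mul, norm_inv, Complex.norm_real, Real.norm_of_nonneg (hpos x).le,
      inv_mul_le_iff₀ (hpos x)]
    linarith
  have : ((mulOp μ w).graph : Set (Lp ℂ 2 μ × Lp ℂ 2 μ)) =
      {p | boundedMul μ hm hm1 p.2 = boundedMul μ hm' hm1' p.1} := by
    ext p
    rw [SetLike.mem_coe, mem_mulOp_graph, Set.mem_ofPred_eq, Lp.ext_iff]
    constructor
    · intro h
      filter_upwards [h, boundedMul_ae hm hm1 p.2, boundedMul_ae hm' hm1' p.1] with x h1 h2 h3
      rw [h2, h3, h1, mul_assoc]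
    · intro h
      filter_upwards [h, boundedMul_ae hm hm1 p.2, boundedMul_ae hm' hm1' p.1] with x h1 h2 h3
      rw [h2, h3, mul_assoc] at h1
      exact mul_left_cancel₀ (inv_ne_zero (Complex.ofReal_ne_zero.2 (hpos x).ne')) h1
  rw [this]
  exact isClosed_eq (by fun_prop) (by fun_prop)

/-- Dominated convergence, with `|m k - 1|² ≤ 4` giving the majorant `4 ‖f‖²`. -/
theorem tendsto_boundedMul {m : ℕ → X → ℂ} (hm : ∀ k, Measurable (m k))
    (hm1 : ∀ k x, ‖m k x‖ ≤ 1) (hlim : ∀ x, ∀ᶠ k in Filter.atTop, m k x = 1) (f : Lp ℂ 2 μ) :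
    Filter.Tendsto (fun k => boundedMul μ (hm k) (hm1 k) f) Filter.atTop (nhds f) := by
  rw [tendsto_iff_norm_sub_tendsto_zero]
  have hsq : Filter.Tendsto (fun k => ‖boundedMul μ (hm k) (hm1 k) f - f‖ ^ 2) Filter.atTop
      (nhds 0) := by
    have h1 : ∀ k, ‖boundedMul μ (hm k) (hm1 k) f - f‖ ^ 2 = ∫ x, ‖(m k x - 1) * f x‖ ^ 2 ∂μ := by
      intro k
      rw [← inner_self_eq_norm_sq (𝕜 := ℂ), L2.inner_def, ← integral_re (L2.integrable_inner _ _)]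
      refine integral_congr_ae ?_
      filter_upwards [Lp.coeFn_sub (boundedMul μ (hm k) (hm1 k) f) f,
        boundedMul_ae (hm k) (hm1 k) f] with x h2 h3
      rw [h2, Pi.sub_apply, h3, inner_self_eq_norm_sq, sub_mul, one_mul]
    simp_rw [h1]
    rw [show (0 : ℝ) = ∫ _, (0 : ℝ) ∂μ by simp]
    refine tendsto_integral_of_dominated_convergence (fun x => 4 * ‖f x‖ ^ 2) (fun k => ?_) ?_
      (fun k => ?_) ?_
    · exact ((((hm k).sub measurable_const).aestronglyMeasurable).mul
        (Lp.aestronglyMeasurable f)).norm.pow 2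
    · exact ((memLp_two_iff_integrable_sq_norm (Lp.aestronglyMeasurable f)).1
        (Lp.memLp f)).const_mul 4
    · refine Filter.Eventually.of_forall fun x => ?_
      have : ‖m k x - 1‖ ≤ 2 := (norm_sub_le _ _).trans (by
        rw [norm_one]; linarith [hm1 k x])
      rw [Real.norm_of_nonneg (sq_nonneg _), norm_mul, mul_pow]
      gcongr
      nlinarith [norm_nonneg (m k x - 1)]
    · refine Filter.Eventually.of_forall fun x => ?_
      refine tendsto_const_nhds.congr' ?_
      filter_upwards [hlim x] with k hk
      simp [hk]
  have := hsq.sqrt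
  simpa [Real.sqrt_sq] using this

end MulOp

/-! ### Symmetrization and passage between Fock space and its sectors -/

section Sector

variable {X : Type*} [MeasurableSpace X] {μ : Measure X} [SigmaFinite μ] {n : ℕ}

/-- The average over all permutations of the variables. -/
def permAverage (μ : Measure X) [SigmaFinite μ] (n : ℕ) :
    Lp ℂ 2 (Measure.pi fun _ : Fin n => μ) →L[ℂ] Lp ℂ 2 (Measure.pi fun _ : Fin n => μ) :=
  ((n.factorial : ℂ)⁻¹) • ∑ σ : Equiv.Perm (Fin n),
    (Lp.compMeasurePreservingₗᵢ ℂ (fun x : Fin n → X => x ∘ σ)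
      (measurePreserving_perm μ σ)).toContinuousLinearMap

theorem permAverage_apply (F : Lp ℂ 2 (Measure.pi fun _ : Fin n => μ)) :
    permAverage μ n F = ((n.factorial : ℂ)⁻¹) • ∑ σ : Equiv.Perm (Fin n),
      Lp.compMeasurePreservingₗ ℂ (fun x : Fin n → X => x ∘ σ) (measurePreserving_perm μ σ) F := by
  rw [permAverage, smul_apply, sum_apply]
  rfl

theorem permAverage_mem (F : Lp ℂ 2 (Measure.pi fun _ : Fin n => μ)) :
    permAverage μ n F ∈ symSector μ n := by
  rw [symSector, Submodule.mem_iInf]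
  intro τ
  rw [LinearMap.mem_eqLocus, LinearMap.id_apply, permAverage_apply, map_smul, map_sum]
  congr 1
  refine Fintype.sum_equiv (Equiv.mulLeft τ) _ _ fun σ => ?_
  exact (Lp.compMeasurePreserving_comp_apply F (measurePreserving_perm μ σ)
    (measurePreserving_perm μ τ)).symm

/-- The orthogonal projection of `L²(Xⁿ, μⁿ)` onto the symmetric functions. -/
def symProj (μ : Measure X) [SigmaFinite μ] (n : ℕ) :
    Lp ℂ 2 (Measure.pi fun _ : Fin n => μ) →L[ℂ] symSector μ n :=
  (permAverage μ n).codRestrict (symSector μ n) permAverage_mem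

theorem coe_symProj (F : Lp ℂ 2 (Measure.pi fun _ : Fin n => μ)) :
    (symProj μ n F : Lp ℂ 2 (Measure.pi fun _ : Fin n => μ)) = permAverage μ n F := rfl

theorem symProj_tensor (f : Fin n → Lp ℂ 2 μ) : symProj μ n (tensor f) = symTensor f := by
  refine Subtype.ext ?_
  rw [coe_symProj, permAverage_apply]
  simp_rw [comp_tensor]
  change _ = ((n.factorial : ℂ)⁻¹) • ∑ σ : Equiv.Perm (Fin n), tensor (fun i => f (σ i))
  congr 1
  exact Fintype.sum_equiv (Equiv.inv _) _ _ fun σ => rfl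

theorem symProj_coe (u : symSector μ n) : symProj μ n u = u := by
  refine Subtype.ext ?_
  rw [coe_symProj, permAverage_apply]
  have h : ∀ σ : Equiv.Perm (Fin n), Lp.compMeasurePreservingₗ ℂ (fun x : Fin n → X => x ∘ σ)
      (measurePreserving_perm μ σ) (u : Lp ℂ 2 (Measure.pi fun _ : Fin n => μ)) = u := fun σ => by
    exact (Submodule.mem_iInf _).1 u.2 σ
  simp_rw [h, Finset.sum_const, Finset.card_univ, Fintype.card_perm, Fintype.card_fin]
  rw [← Nat.cast_smul_eq_nsmul ℂ, smul_smul, inv_mul_cancel₀, one_smul]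
  exact_mod_cast n.factorial_ne_zero

theorem norm_symProj_le (F : Lp ℂ 2 (Measure.pi fun _ : Fin n => μ)) : ‖symProj μ n F‖ ≤ ‖F‖ := by
  change ‖permAverage μ n F‖ ≤ ‖F‖
  rw [ permAverage_apply, norm_smul, norm_inv, Complex.norm_natCast]
  have hf : (0 : ℝ) < n.factorial := by exact_mod_cast n.factorial_pos
  rw [inv_mul_le_iff₀ hf]
  refine (norm_sum_le _ _).trans ?_
  simp [Fintype.card_perm]

/-- The graph of `∑ j, 1 ⊗ ⋯ ⊗ A ⊗ ⋯ ⊗ 1` on the algebraic (unsymmetrized) tensor power of the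
domain of `A`. -/
def tensorGraph (A : Lp ℂ 2 μ →ₗ.[ℂ] Lp ℂ 2 μ) (n : ℕ) :
    Submodule ℂ (Lp ℂ 2 (Measure.pi fun _ : Fin n => μ) ×
      Lp ℂ 2 (Measure.pi fun _ : Fin n => μ)) :=
  Submodule.span ℂ {p | ∃ f : Fin n → A.domain, p.1 = tensor (fun i => (f i : Lp ℂ 2 μ)) ∧
    p.2 = ∑ j : Fin n, tensor (Function.update (fun i => (f i : Lp ℂ 2 μ)) j (A (f j)))}

theorem symTensor_mem_tensorGraph (A : Lp ℂ 2 μ →ₗ.[ℂ] Lp ℂ 2 μ) (f : Fin n → A.domain) :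
    (((symTensor fun i => (f i : Lp ℂ 2 μ) : symSector μ n) :
        Lp ℂ 2 (Measure.pi fun _ : Fin n => μ)),
      ((∑ j : Fin n, symTensor (Function.update (fun i => (f i : Lp ℂ 2 μ)) j (A (f j))) :
        symSector μ n) : Lp ℂ 2 (Measure.pi fun _ : Fin n => μ))) ∈ tensorGraph A n := by
  have h : (((symTensor fun i => (f i : Lp ℂ 2 μ) : symSector μ n) :
        Lp ℂ 2 (Measure.pi fun _ : Fin n => μ)),
      ((∑ j : Fin n, symTensor (Function.update (fun i => (f i : Lp ℂ 2 μ)) j (A (f j))) :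
        symSector μ n) : Lp ℂ 2 (Measure.pi fun _ : Fin n => μ))) =
      ((n.factorial : ℂ)⁻¹) • ∑ σ : Equiv.Perm (Fin n),
        (tensor (fun i => (f (σ i) : Lp ℂ 2 μ)), ∑ j : Fin n,
          tensor (Function.update (fun i => (f (σ i) : Lp ℂ 2 μ)) j (A (f (σ j))))) := by
    refine Prod.ext ?_ ?_
    · rw [Prod.smul_fst, Prod.fst_sum]
      rfl
    · rw [Prod.smul_snd, Prod.snd_sum, Submodule.coe_sum]
      change ∑ j : Fin n, ((n.factorial : ℂ)⁻¹) • ∑ σ : Equiv.Perm (Fin n), tensor (fun i =>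
        Function.update (fun i => (f i : Lp ℂ 2 μ)) j (A (f j)) (σ i)) = _
      rw [← Finset.smul_sum, Finset.sum_comm]
      congr 1
      refine Finset.sum_congr rfl fun σ _ => ?_
      -- After permuting the factors by `σ`, the slot carrying `A` moves: slot `j` of the permuted
      -- vector is slot `σ j` of the original one.
      refine (Fintype.sum_equiv σ _ _ fun j => ?_).symm
      congr 1
      funext i
      by_cases hij : i = j
      · subst hij; simp
      · rw [Function.update_of_ne hij, Function.update_of_ne (σ.injective.ne hij)]
  rw [h]
  exact Submodule.smul_mem _ _ (Submodule.sum_mem _ fun σ _ =>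
    Submodule.subset_span ⟨fun i => f (σ i), rfl, rfl⟩)

/-- The pair of components in the `n`-particle space of a pair of Fock space vectors. -/
def sectorPair (μ : Measure X) [SigmaFinite μ] (n : ℕ) :
    Fock μ × Fock μ →L[ℂ] Lp ℂ 2 (Measure.pi fun _ : Fin n => μ) ×
      Lp ℂ 2 (Measure.pi fun _ : Fin n => μ) :=
  ((symSector μ n).subtypeL ∘L lp.evalCLM ℂ (fun n : ℕ => symSector μ n) 2 n).prodMap
    ((symSector μ n).subtypeL ∘L lp.evalCLM ℂ (fun n : ℕ => symSector μ n) 2 n)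

theorem sectorPair_apply (p : Fock μ × Fock μ) :
    sectorPair μ n p = ((p.1 n : Lp ℂ 2 (Measure.pi fun _ : Fin n => μ)), ↑(p.2 n)) := rfl

/-- The pair of Fock space vectors given by the symmetrizations of a pair in `L²(Xⁿ, μⁿ)`. -/
def fockPair (μ : Measure X) [SigmaFinite μ] (n : ℕ) :
    Lp ℂ 2 (Measure.pi fun _ : Fin n => μ) × Lp ℂ 2 (Measure.pi fun _ : Fin n => μ) →L[ℂ]
      Fock μ × Fock μ :=
  (lp.singleContinuousLinearMap ℂ (fun n : ℕ => symSector μ n) 2 n ∘L symProj μ n).prodMap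
    (lp.singleContinuousLinearMap ℂ (fun n : ℕ => symSector μ n) 2 n ∘L symProj μ n)

theorem fockPair_apply (p : Lp ℂ 2 (Measure.pi fun _ : Fin n => μ) ×
    Lp ℂ 2 (Measure.pi fun _ : Fin n => μ)) :
    fockPair μ n p = (lp.single 2 n (symProj μ n p.1), lp.single 2 n (symProj μ n p.2)) := rfl

theorem sectorPair_mem_tensorGraph {A : Lp ℂ 2 μ →ₗ.[ℂ] Lp ℂ 2 μ} (n : ℕ) {p : Fock μ × Fock μ}
    (hp : p ∈ dGammaAlgGraph A) : sectorPair μ n p ∈ tensorGraph A n := by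
  have h : dGammaAlgGraph A ≤ (tensorGraph A n).comap (sectorPair μ n : _ →ₗ[ℂ] _) := by
    refine Submodule.span_le.2 ?_
    rintro q ⟨m, f, h1, h2⟩
    rw [SetLike.mem_coe, Submodule.mem_comap, ContinuousLinearMap.coe_coe, sectorPair_apply, h1, h2]
    by_cases hmn : n = m
    · subst hmn
      rw [lp.single_apply_self, lp.single_apply_self]
      exact symTensor_mem_tensorGraph A f
    · rw [lp.single_apply_ne _ _ _ hmn, lp.single_apply_ne _ _ _ hmn]
      exact Submodule.zero_mem _
  exact h hp

theorem sectorPair_mem_closure {A : Lp ℂ 2 μ →ₗ.[ℂ] Lp ℂ 2 μ} (n : ℕ) {p : Fock μ × Fock μ}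
    (hp : p ∈ (dGammaAlgGraph A).topologicalClosure) :
    sectorPair μ n p ∈ (tensorGraph A n).topologicalClosure :=
  map_mem_closure (sectorPair μ n).continuous hp fun _ hq => sectorPair_mem_tensorGraph n hq

theorem fockPair_mem_closure {A : Lp ℂ 2 μ →ₗ.[ℂ] Lp ℂ 2 μ}
    {p : Lp ℂ 2 (Measure.pi fun _ : Fin n => μ) × Lp ℂ 2 (Measure.pi fun _ : Fin n => μ)}
    (hp : p ∈ (tensorGraph A n).topologicalClosure) :
    fockPair μ n p ∈ (dGammaAlgGraph A).topologicalClosure := by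
  refine map_mem_closure (fockPair μ n).continuous hp fun q hq => ?_
  have h : tensorGraph A n ≤ (dGammaAlgGraph A).comap (fockPair μ n : _ →ₗ[ℂ] _) := by
    refine Submodule.span_le.2 ?_
    rintro q ⟨f, h1, h2⟩
    refine Submodule.subset_span ⟨n, f, ?_, ?_⟩
    · rw [ContinuousLinearMap.coe_coe, fockPair_apply, h1, symProj_tensor]
    · rw [ContinuousLinearMap.coe_coe, fockPair_apply, h2, map_sum]
      simp_rw [symProj_tensor]
  exact h hq

/-- A Fock vector is the norm-convergent sum of its components, so membership in a closed subspace
can be tested on them. -/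
theorem mem_of_single_mem {S : Submodule ℂ (Fock μ × Fock μ)} (hS : IsClosed (S : Set (Fock μ × Fock μ)))
    {p : Fock μ × Fock μ} (h : ∀ n, ((lp.single 2 n (p.1 n) : Fock μ), (lp.single 2 n (p.2 n) : Fock μ)) ∈ S) :
    p ∈ S := by
  have h1 := lp.hasSum_single (E := fun n : ℕ => symSector μ n) (p := 2) (by simp) p.1
  have h2 := lp.hasSum_single (E := fun n : ℕ => symSector μ n) (p := 2) (by simp) p.2
  have h3 := h1.prodMk h2
  refine hS.mem_of_tendsto h3 (Filter.Eventually.of_forall fun s => ?_)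
  exact Submodule.sum_mem _ fun n _ => h n

end Sector

/-! ### Spectral representation of second quantizations -/

section Diagonal

variable {X : Type*} [MeasurableSpace X] {μ : Measure X} [SigmaFinite μ] {n : ℕ}

/-- The unitary operator `U` diagonalizes `A`: `U A U⁻¹` is multiplication by `w`, on its maximal
domain. -/
def IsDiagonalizedBy (A : Lp ℂ 2 μ →ₗ.[ℂ] Lp ℂ 2 μ) (U : Lp ℂ 2 μ ≃ₗᵢ[ℂ] Lp ℂ 2 μ)
    (w : X → ℝ) : Prop :=
  ∀ f g : Lp ℂ 2 μ, (f, g) ∈ A.graph ↔ U g =ᵐ[μ] fun x => (w x : ℂ) * U f x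

theorem sum_tensor_update_ae {g h : Fin n → Lp ℂ 2 μ} {w : X → ℂ}
    (hgh : ∀ j, h j =ᵐ[μ] fun x => w x * g j x) :
    ((∑ j, tensor (Function.update g j (h j)) : Lp ℂ 2 (Measure.pi fun _ : Fin n => μ)) :
      (Fin n → X) → ℂ) =ᵐ[Measure.pi fun _ : Fin n => μ]
      fun x => (∑ j, w (x j)) * tensor g x := by
  filter_upwards [Lp.coeFn_finsetSum Finset.univ (fun j => tensor (Function.update g j (h j))),
    tensor_ae g, ae_all_iff.2 fun j => update_ae g j (h j), ae_eval_all hgh] with x h1 h2 h3 h4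
  rw [h1, h2, Finset.sum_mul, Finset.sum_apply]
  refine Finset.sum_congr rfl fun j _ => ?_
  rw [h3 j, h4 j, mul_assoc, Finset.mul_prod_erase Finset.univ (fun i => g i (x i))
    (Finset.mem_univ j)]

theorem tensorPower_tensor_update (U : Lp ℂ 2 μ ≃ₗᵢ[ℂ] Lp ℂ 2 μ) (f : Fin n → Lp ℂ 2 μ) (j : Fin n)
    (u : Lp ℂ 2 μ) : tensorPower n U (tensor (Function.update f j u)) =
      tensor (Function.update (fun i => U (f i)) j (U u)) := by
  rw [tensorPower_tensor]
  congr 1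
  funext i
  exact Function.apply_update (fun _ => U) f j u i

theorem measurable_sum_eval {w : X → ℂ} (hw : Measurable w) :
    Measurable fun x : Fin n → X => ∑ j, w (x j) :=
  Finset.measurable_sum _ fun j _ => hw.comp (measurable_pi_apply j)

variable {A : Lp ℂ 2 μ →ₗ.[ℂ] Lp ℂ 2 μ} {U : Lp ℂ 2 μ ≃ₗᵢ[ℂ] Lp ℂ 2 μ} {w : X → ℝ}

/-- On product vectors this is a direct computation; it survives the closure because a maximal
multiplication operator has a closed graph. -/
theorem IsDiagonalizedBy.ae_of_mem_closure (hA : IsDiagonalizedBy A U w) (hw : Measurable w)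
    {p : Lp ℂ 2 (Measure.pi fun _ : Fin n => μ) × Lp ℂ 2 (Measure.pi fun _ : Fin n => μ)}
    (hp : p ∈ (tensorGraph A n).topologicalClosure) :
    tensorPower n U p.2 =ᵐ[Measure.pi fun _ : Fin n => μ]
      fun x => (∑ j, (w (x j) : ℂ)) * tensorPower n U p.1 x := by
  let L : Lp ℂ 2 (Measure.pi fun _ : Fin n => μ) × Lp ℂ 2 (Measure.pi fun _ : Fin n => μ) →L[ℂ]
      Lp ℂ 2 (Measure.pi fun _ : Fin n => μ) × Lp ℂ 2 (Measure.pi fun _ : Fin n => μ) :=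
    (tensorPower n U).toContinuousLinearEquiv.toContinuousLinearMap.prodMap
      (tensorPower n U).toContinuousLinearEquiv.toContinuousLinearMap
  let M := (mulOp (Measure.pi fun _ : Fin n => μ) fun x => ∑ j, (w (x j) : ℂ)).graph
  have hle : tensorGraph A n ≤ M.comap (L : _ →ₗ[ℂ] _) := by
    refine Submodule.span_le.2 ?_
    rintro q ⟨f, h1, h2⟩
    refine mem_mulOp_graph.2 ?_
    change tensorPower n U q.2 =ᵐ[_] fun x => (∑ j, (w (x j) : ℂ)) * tensorPower n U q.1 x
    rw [h1, h2, map_sum, tensorPower_tensor]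
    simp_rw [tensorPower_tensor_update]
    exact sum_tensor_update_ae (w := fun x => (w x : ℂ)) fun j => (hA _ _).1 (A.mem_graph (f j))
  have hcl : IsClosed (M : Set (Lp ℂ 2 (Measure.pi fun _ : Fin n => μ) ×
      Lp ℂ 2 (Measure.pi fun _ : Fin n => μ))) :=
    isClosed_mulOp_graph (measurable_sum_eval (w := fun x => (w x : ℂ)) (by fun_prop))
  have : L p ∈ closure (M : Set _) := map_mem_closure L.continuous hp fun q hq => hle hq
  rw [hcl.closure_eq] at this
  exact mem_mulOp_graph.1 this

/-- The algebraic tensor power is a core for the maximal multiplication operator. Where all `|w (x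
j)| ≤ k`, both the cutoff and its product with `∑ w` are bounded, and they send product vectors into
the algebraic graph; density of product vectors gives every `F`, and `k → ∞` removes the cutoff. -/
theorem IsDiagonalizedBy.mem_closure_of_ae (hA : IsDiagonalizedBy A U w) (hw : Measurable w)
    {F G : Lp ℂ 2 (Measure.pi fun _ : Fin n => μ)}
    (h : G =ᵐ[Measure.pi fun _ : Fin n => μ] fun x => (∑ j, (w (x j) : ℂ)) * F x) :
    ((tensorPower n U).symm F, (tensorPower n U).symm G) ∈ (tensorGraph A n).topologicalClosure := by
  -- The cutoff acts on each variable separately, not on `∑ w`, so that its product `χ k` maps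
  -- product vectors to product vectors.
  let c : ℕ → X → ℂ := fun k => {x | |w x| ≤ k}.indicator 1
  have hc : ∀ k, Measurable (c k) := fun k =>
    measurable_one.indicator (measurableSet_le (by fun_prop) measurable_const)
  have hc1 : ∀ k x, ‖c k x‖ ≤ 1 := fun k x => by
    by_cases hx : x ∈ {x | |w x| ≤ k} <;> simp [c, hx]
  have hcw : ∀ k, Measurable fun x => (w x : ℂ) * c k x := fun k => by
    exact (Complex.measurable_ofReal.comp hw).mul (hc k)
  have hcw1 : ∀ k x, ‖(w x : ℂ) * c k x‖ ≤ k := fun k x => by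
    by_cases hx : |w x| ≤ k <;> simp [c, hx]
  let χ : ℕ → (Fin n → X) → ℂ := fun k x => ∏ j, c k (x j)
  have hχ : ∀ k, Measurable (χ k) := fun k =>
    Finset.measurable_prod _ fun j _ => (hc k).comp (measurable_pi_apply j)
  have hχ1 : ∀ k x, ‖χ k x‖ ≤ 1 := fun k x => by
    rw [norm_prod]
    exact Finset.prod_le_one (fun _ _ => norm_nonneg _) fun j _ => hc1 k _
  have hW : Measurable fun x : Fin n → X => ∑ j, (w (x j) : ℂ) :=
    measurable_sum_eval (w := fun x => (w x : ℂ)) (by fun_prop)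
  have hχw : ∀ k, Measurable fun x => (∑ j, (w (x j) : ℂ)) * χ k x := fun k => hW.mul (hχ k)
  have hχw1 : ∀ k x, ‖(∑ j, (w (x j) : ℂ)) * χ k x‖ ≤ n * k := fun k x => by
    by_cases hx : ∀ j, |w (x j)| ≤ k
    · have : ‖∑ j, (w (x j) : ℂ)‖ ≤ n * k := by
        refine (norm_sum_le_of_le (Finset.univ : Finset (Fin n)) (n := fun _ => (k : ℝ))
          fun j _ => ?_).trans ?_
        · rw [Complex.norm_real]; exact hx j
        · simp
      rw [norm_mul]
      exact (mul_le_of_le_one_right (norm_nonneg _) (hχ1 k x)).trans this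
    · push Not at hx
      obtain ⟨j, hj⟩ := hx
      have : χ k x = 0 := Finset.prod_eq_zero (Finset.mem_univ j) (by
        simp [c, not_le.2 hj])
      rw [this, mul_zero, norm_zero]
      positivity
  have hlim : ∀ x, ∀ᶠ k in Filter.atTop, χ k x = 1 := fun x => by
    have : ∀ j, ∀ᶠ k : ℕ in Filter.atTop, c k (x j) = 1 := fun j => by
      obtain ⟨N, hN⟩ := exists_nat_ge |w (x j)|
      filter_upwards [Filter.eventually_ge_atTop N] with k hk
      have : |w (x j)| ≤ k := hN.trans (by exact_mod_cast hk)
      simp [c, this]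
    filter_upwards [Filter.eventually_all.2 this] with k hk
    exact Finset.prod_eq_one fun j _ => hk j
  have hmem : ∀ k (F : Lp ℂ 2 (Measure.pi fun _ : Fin n => μ)),
      ((tensorPower n U).symm (boundedMul _ (hχ k) (hχ1 k) F),
        (tensorPower n U).symm (boundedMul _ (hχw k) (hχw1 k) F)) ∈
          (tensorGraph A n).topologicalClosure := by
    intro k F
    let V := (tensorPower n U).symm.toContinuousLinearEquiv.toContinuousLinearMap
    let L : Lp ℂ 2 (Measure.pi fun _ : Fin n => μ) →L[ℂ]
        Lp ℂ 2 (Measure.pi fun _ : Fin n => μ) × Lp ℂ 2 (Measure.pi fun _ : Fin n => μ) :=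
      (V ∘L boundedMul _ (hχ k) (hχ1 k)).prod (V ∘L boundedMul _ (hχw k) (hχw1 k))
    have hle : Submodule.span ℂ (Set.range (tensor (μ := μ) (n := n))) ≤
        (tensorGraph A n).comap (L : _ →ₗ[ℂ] _) := by
      refine Submodule.span_le.2 ?_
      rintro _ ⟨f, rfl⟩
      let g : Fin n → Lp ℂ 2 μ := fun i => boundedMul μ (hc k) (hc1 k) (f i)
      let h : Fin n → Lp ℂ 2 μ := fun i => boundedMul μ (hcw k) (hcw1 k) (f i)
      have hgh : ∀ j, h j =ᵐ[μ] fun x => (w x : ℂ) * g j x := fun j => by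
        filter_upwards [boundedMul_ae (hc k) (hc1 k) (f j),
          boundedMul_ae (hcw k) (hcw1 k) (f j)] with x h1 h2
        rw [h1, h2, mul_assoc]
      have hAg : ∀ j, (U.symm (g j), U.symm (h j)) ∈ A.graph := fun j => by
        rw [hA]
        simpa using hgh j
      have e1 : boundedMul _ (hχ k) (hχ1 k) (tensor f) = tensor g := by
        refine Lp.ext ?_
        filter_upwards [boundedMul_ae (hχ k) (hχ1 k) (tensor f), tensor_ae f,
          tensor_ae_of_ae fun i => boundedMul_ae (hc k) (hc1 k) (f i)] with x h1 h2 h3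
        rw [h1, h2, h3, Finset.prod_mul_distrib]
      have e2 : boundedMul _ (hχw k) (hχw1 k) (tensor f) =
          ∑ j, tensor (Function.update g j (h j)) := by
        refine Lp.ext ?_
        have e1' := Lp.ext_iff.1 e1
        filter_upwards [boundedMul_ae (hχw k) (hχw1 k) (tensor f),
          boundedMul_ae (hχ k) (hχ1 k) (tensor f), e1', sum_tensor_update_ae hgh]
          with x h1 h2 h3 h4
        rw [h1, h4, ← h3, h2, mul_assoc]
      choose z hz using fun j => (LinearPMap.mem_graph_iff A).1 (hAg j)
      refine Submodule.subset_span ⟨z, ?_, ?_⟩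
      · change (tensorPower n U).symm (boundedMul _ (hχ k) (hχ1 k) (tensor f)) = _
        rw [e1, tensorPower_symm_tensor]
        congr 1
        funext i
        exact (hz i).1.symm
      · change (tensorPower n U).symm (boundedMul _ (hχw k) (hχw1 k) (tensor f)) = _
        rw [e2, LinearIsometryEquiv.symm_apply_eq, map_sum]
        refine Finset.sum_congr rfl fun j _ => ?_
        rw [tensorPower_tensor_update]
        congr 1
        rw [(hz j).2]
        simp_rw [fun i => (hz i).1]
        simp
    change L F ∈ _
    exact map_mem_closure L.continuous (dense_span_tensor μ n F) fun q hq => hle hq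
  -- Since `G = (∑ w) F`, the second component is just the cutoff of `G`, so it converges to `G`.
  have heq : ∀ k, boundedMul _ (hχw k) (hχw1 k) F = boundedMul _ (hχ k) (hχ1 k) G := fun k => by
    refine Lp.ext ?_
    filter_upwards [boundedMul_ae (hχw k) (hχw1 k) F, boundedMul_ae (hχ k) (hχ1 k) G, h]
      with x h1 h2 h3
    rw [h1, h2, h3]
    ring
  refine (tensorGraph A n).isClosed_topologicalClosure.mem_of_tendsto
    (b := Filter.atTop) ?_ (Filter.Eventually.of_forall fun k => hmem k F)
  simp_rw [heq]
  exact (((tensorPower n U).symm.continuous.tendsto _).comp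
    (tendsto_boundedMul hχ hχ1 hlim F)).prodMk_nhds
    (((tensorPower n U).symm.continuous.tendsto _).comp (tendsto_boundedMul hχ hχ1 hlim G))

/-- This is closability: without it the closure need not be the graph of the operator extracted from
it by `dGamma`. -/
theorem IsDiagonalizedBy.snd_eq_zero (hA : IsDiagonalizedBy A U w) (hw : Measurable w)
    {p : Fock μ × Fock μ} (hp : p ∈ (dGammaAlgGraph A).topologicalClosure) (h0 : p.1 = 0) :
    p.2 = 0 := by
  ext1
  funext n
  have h := hA.ae_of_mem_closure hw (sectorPair_mem_closure n hp)
  rw [sectorPair_apply, h0] at h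
  refine Subtype.ext ?_
  change (p.2 n : Lp ℂ 2 (Measure.pi fun _ : Fin n => μ)) = 0
  rw [← (tensorPower n U).map_eq_zero_iff, Lp.eq_zero_iff_ae_eq_zero]
  have h' : tensorPower n U ((0 : Fock μ) n : symSector μ n) = 0 := map_zero (tensorPower n U)
  filter_upwards [h, Lp.coeFn_zero ℂ 2 (Measure.pi fun _ : Fin n => μ)] with x h1 h2
  simp only [h'] at h1
  rw [h1, h2]
  simp

theorem IsDiagonalizedBy.dGamma_graph (hA : IsDiagonalizedBy A U w) (hw : Measurable w) :
    (dGamma A).graph = (dGammaAlgGraph A).topologicalClosure :=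
  Submodule.toLinearPMap_graph_eq _ fun _ hp h0 => hA.snd_eq_zero hw hp h0

theorem IsDiagonalizedBy.dGamma_ae (hA : IsDiagonalizedBy A U w) (hw : Measurable w)
    {Φ Ψ : Fock μ} (h : (Φ, Ψ) ∈ (dGamma A).graph) (n : ℕ) :
    tensorPower n U (Ψ n : symSector μ n) =ᵐ[Measure.pi fun _ : Fin n => μ]
      fun x => (∑ j, (w (x j) : ℂ)) * tensorPower n U (Φ n : symSector μ n) x := by
  rw [hA.dGamma_graph hw] at h
  exact hA.ae_of_mem_closure hw (sectorPair_mem_closure n h)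

end Diagonal

/-! ### The resolvent of a second quantization -/

section Resolvent

variable {X : Type*} [MeasurableSpace X] {μ : Measure X} [SigmaFinite μ] {n : ℕ}
  {A : Lp ℂ 2 μ →ₗ.[ℂ] Lp ℂ 2 μ} {U : Lp ℂ 2 μ ≃ₗᵢ[ℂ] Lp ℂ 2 μ} {w : X → ℝ}

/-- The multiplier `(∑ j, w (x j) + ρ)⁻¹` of the resolvent of a second quantization. -/
def resolventMultiplier (w : X → ℝ) (ρ : ℝ) (n : ℕ) (x : Fin n → X) : ℂ :=
  (((∑ j, w (x j)) + ρ : ℝ) : ℂ)⁻¹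

theorem measurable_resolventMultiplier (hw : Measurable w) (ρ : ℝ) (n : ℕ) :
    Measurable (resolventMultiplier w ρ n) := by
  have : Measurable fun x : Fin n → X => ∑ j, w (x j) :=
    Finset.measurable_sum _ fun j _ => hw.comp (measurable_pi_apply j)
  unfold resolventMultiplier
  fun_prop

theorem norm_resolventMultiplier_le {X : Type*} {w : X → ℝ} (h0 : ∀ x, 0 ≤ w x) {ρ : ℝ} (hρ : 0 < ρ) (n : ℕ)
    (x : Fin n → X) : ‖resolventMultiplier w ρ n x‖ ≤ ρ⁻¹ := by
  have hs : 0 ≤ ∑ j, w (x j) := Finset.sum_nonneg fun j _ => h0 _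
  rw [resolventMultiplier, norm_inv, Complex.norm_real, Real.norm_of_nonneg (by linarith)]
  exact inv_anti₀ hρ (by linarith)

/-- The resolvent `(dΓ(A) + ρ)⁻¹` in the `n`-particle space, for `A` diagonalized by `U`. -/
def sectorResolvent (U : Lp ℂ 2 μ ≃ₗᵢ[ℂ] Lp ℂ 2 μ) (hw : Measurable w) (h0 : ∀ x, 0 ≤ w x) {ρ : ℝ}
    (hρ : 0 < ρ) (n : ℕ) : symSector μ n →L[ℂ] symSector μ n :=
  symProj μ n ∘L (tensorPower n U).symm.toContinuousLinearEquiv.toContinuousLinearMap ∘L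
    boundedMul _ (measurable_resolventMultiplier hw ρ n) (norm_resolventMultiplier_le h0 hρ n) ∘L
    (tensorPower n U).toContinuousLinearEquiv.toContinuousLinearMap ∘L (symSector μ n).subtypeL

theorem norm_sectorResolvent_le' (hw : Measurable w) (h0 : ∀ x, 0 ≤ w x) {ρ : ℝ}
    (hρ : 0 < ρ) (u : symSector μ n) : ‖sectorResolvent U hw h0 hρ n u‖ ≤
      ‖boundedMul _ (measurable_resolventMultiplier hw ρ n) (norm_resolventMultiplier_le h0 hρ n)
        (tensorPower n U u)‖ := by
  refine (norm_symProj_le _).trans (le_of_eq ?_)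
  exact (tensorPower n U).symm.norm_map _

theorem norm_sectorResolvent_le (hw : Measurable w) (h0 : ∀ x, 0 ≤ w x) {ρ : ℝ}
    (hρ : 0 < ρ) (u : symSector μ n) : ‖sectorResolvent U hw h0 hρ n u‖ ≤ ρ⁻¹ * ‖u‖ :=
  (norm_sectorResolvent_le' hw h0 hρ u).trans <| (norm_boundedMul_apply_le _ _ _).trans_eq <| by
    rw [LinearIsometryEquiv.norm_map]; rfl

/-- In the spectral representation, divide by `∑ w + ρ`; the quotient `F` satisfies `(∑ w) F = Ψ - ρ
F`. Symmetrizing the resulting pair returns it to Fock space, with no need to check that the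
multiplier preserves symmetry. -/
theorem IsDiagonalizedBy.exists_resolvent (hA : IsDiagonalizedBy A U w) (hw : Measurable w)
    (h0 : ∀ x, 0 ≤ w x) {ρ : ℝ} (hρ : 0 < ρ) (Ψ : Fock μ) :
    ∃ Φ : Fock μ, (Φ, Ψ - (ρ : ℂ) • Φ) ∈ (dGamma A).graph ∧
      ∀ n, Φ n = sectorResolvent U hw h0 hρ n (Ψ n) := by
  have hmem : Memℓp (fun n => sectorResolvent U hw h0 hρ n (Ψ n)) 2 :=
    (((lp.memℓp Ψ).norm).const_mul ρ⁻¹).mono fun n => norm_sectorResolvent_le hw h0 hρ (Ψ n)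
  refine ⟨⟨_, hmem⟩, ?_, fun n => rfl⟩
  rw [hA.dGamma_graph hw]
  refine mem_of_single_mem (Submodule.isClosed_topologicalClosure _) fun n => ?_
  have hm := measurable_resolventMultiplier hw ρ n
  have hm1 := norm_resolventMultiplier_le h0 hρ n
  set F := boundedMul _ hm hm1 (tensorPower n U (Ψ n)) with hF
  have hG : ((tensorPower n U (Ψ n) - (ρ : ℂ) • F : Lp ℂ 2 (Measure.pi fun _ : Fin n => μ)) :
      (Fin n → X) → ℂ) =ᵐ[Measure.pi fun _ : Fin n => μ] fun x => (∑ j, (w (x j) : ℂ)) * F x := by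
    filter_upwards [Lp.coeFn_sub (tensorPower n U (Ψ n)) ((ρ : ℂ) • F), Lp.coeFn_smul (ρ : ℂ) F,
      boundedMul_ae hm hm1 (tensorPower n U (Ψ n))] with x h1 h2 h3
    rw [h1, Pi.sub_apply, h2, Pi.smul_apply, h3, resolventMultiplier, smul_eq_mul]
    have hs : 0 ≤ ∑ j, w (x j) := Finset.sum_nonneg fun j _ => h0 _
    have hne : (∑ j, (w (x j) : ℂ)) + ρ ≠ 0 := by
      have : (∑ j, w (x j)) + ρ ≠ 0 := by linarith
      exact_mod_cast this
    push_cast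
    field_simp
    ring
  have h := fockPair_mem_closure (hA.mem_closure_of_ae hw hG)
  rw [fockPair_apply] at h
  convert h using 2
  congr 1
  rw [map_sub, map_sub, LinearIsometryEquiv.symm_apply_apply, symProj_coe, map_smul, map_smul]
  rfl

/-- The equation reads `(∑ w + ρ) Φ = Ψ` pointwise in the spectral representation, and `∑ w + ρ ≥ ρ
> 0` can be cancelled. -/
theorem IsDiagonalizedBy.eq_sectorResolvent (hA : IsDiagonalizedBy A U w) (hw : Measurable w)
    (h0 : ∀ x, 0 ≤ w x) {ρ : ℝ} (hρ : 0 < ρ) {Φ Ψ : Fock μ}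
    (h : (Φ, Ψ - (ρ : ℂ) • Φ) ∈ (dGamma A).graph) (n : ℕ) :
    Φ n = sectorResolvent U hw h0 hρ n (Ψ n) := by
  have h1 := hA.dGamma_ae hw h n
  have h2 : tensorPower n U ((Ψ - (ρ : ℂ) • Φ) n : symSector μ n) =
      tensorPower n U (Ψ n) - (ρ : ℂ) • tensorPower n U (Φ n) := by
    rw [lp.coeFn_sub, Pi.sub_apply, lp.coeFn_smul, Pi.smul_apply, Submodule.coe_sub,
      Submodule.coe_smul, map_sub, map_smul]
  rw [h2] at h1
  have h3 : boundedMul _ (measurable_resolventMultiplier hw ρ n)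
      (norm_resolventMultiplier_le h0 hρ n) (tensorPower n U (Ψ n)) = tensorPower n U (Φ n) := by
    refine Lp.ext ?_
    filter_upwards [h1, Lp.coeFn_sub (tensorPower n U (Ψ n)) ((ρ : ℂ) • tensorPower n U (Φ n)),
      Lp.coeFn_smul (ρ : ℂ) (tensorPower n U (Φ n)),
      boundedMul_ae (measurable_resolventMultiplier hw ρ n)
      (norm_resolventMultiplier_le h0 hρ n) (tensorPower n U (Ψ n))] with x h4 h5 h6 h7
    rw [h5, Pi.sub_apply, h6, Pi.smul_apply, smul_eq_mul, sub_eq_iff_eq_add, ← add_mul] at h4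
    have hs : 0 ≤ ∑ j, w (x j) := Finset.sum_nonneg fun j _ => h0 _
    have hne : (∑ j, (w (x j) : ℂ)) + ρ ≠ 0 := by
      have : (∑ j, w (x j)) + ρ ≠ 0 := by linarith
      exact_mod_cast this
    rw [h7, h4, resolventMultiplier]
    push_cast
    rw [inv_mul_cancel_left₀ hne]
  change Φ n = symProj μ n ((tensorPower n U).symm (boundedMul _
    (measurable_resolventMultiplier hw ρ n) (norm_resolventMultiplier_le h0 hρ n)
    (tensorPower n U (Ψ n))))
  rw [h3, LinearIsometryEquiv.symm_apply_apply, symProj_coe]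

theorem vadd_smul_id_mem_graph {E : Type*} [AddCommGroup E] [Module ℂ E] (A : E →ₗ.[ℂ] E) (ρ : ℝ)
    {x y : E} : (x, y) ∈ (((ρ : ℂ) • (LinearMap.id : E →ₗ[ℂ] E)) +ᵥ A).graph ↔
      (x, y - (ρ : ℂ) • x) ∈ A.graph := by
  rw [LinearPMap.mem_graph_iff, LinearPMap.mem_graph_iff]
  constructor
  · rintro ⟨z, h1, h2⟩
    refine ⟨z, h1, ?_⟩
    rw [LinearPMap.vadd_apply] at h2
    simp only [LinearMap.smul_apply, LinearMap.id_apply] at h2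
    simp only at h1
    simp only [← h2, ← h1]
    abel
  · rintro ⟨z, h1, h2⟩
    refine ⟨z, h1, ?_⟩
    rw [LinearPMap.vadd_apply, h2]
    simp only at h1
    simp [h1]

theorem IsDiagonalizedBy.invShift_domain (hA : IsDiagonalizedBy A U w) (hw : Measurable w)
    (h0 : ∀ x, 0 ≤ w x) {ρ : ℝ} (hρ : 0 < ρ) : (invShift (dGamma A) ρ).domain = ⊤ := by
  rw [invShift, LinearPMap.inverse_domain, LinearMap.range_eq_top]
  intro Ψ
  obtain ⟨Φ, hΦ, -⟩ := hA.exists_resolvent hw h0 hρ Ψ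
  rw [← vadd_smul_id_mem_graph, LinearPMap.mem_graph_iff] at hΦ
  obtain ⟨y, -, hy⟩ := hΦ
  exact ⟨y, hy⟩

theorem IsDiagonalizedBy.invShift_apply (hA : IsDiagonalizedBy A U w) (hw : Measurable w)
    (h0 : ∀ x, 0 ≤ w x) {ρ : ℝ} (hρ : 0 < ρ) (Ψ : (invShift (dGamma A) ρ).domain) (n : ℕ) :
    invShift (dGamma A) ρ Ψ n = sectorResolvent U hw h0 hρ n ((Ψ : Fock μ) n) := by
  -- Injectivity is needed for the inverse to have the flipped graph; it is the uniqueness just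
  -- proved, applied to a zero right-hand side.
  have hker : (((ρ : ℂ) • (LinearMap.id : Fock μ →ₗ[ℂ] Fock μ)) +ᵥ dGamma A).toFun.ker = ⊥ := by
    rw [LinearMap.ker_eq_bot']
    intro x hx
    have h := LinearPMap.mem_graph (((ρ : ℂ) • (LinearMap.id : Fock μ →ₗ[ℂ] Fock μ)) +ᵥ dGamma A) x
    rw [vadd_smul_id_mem_graph] at h
    refine Subtype.ext ?_
    change (x : Fock μ) = 0
    ext1
    funext n
    rw [hA.eq_sectorResolvent hw h0 hρ h n]
    rw [← LinearPMap.toFun_eq_coe, hx]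
    exact map_zero _
  have h : ((Ψ : Fock μ), invShift (dGamma A) ρ Ψ) ∈ (LinearPMap.inverse
      (((ρ : ℂ) • (LinearMap.id : Fock μ →ₗ[ℂ] Fock μ)) +ᵥ dGamma A)).graph :=
    LinearPMap.mem_graph _ Ψ
  rw [LinearPMap.inverse_graph hker] at h
  obtain ⟨q, hq, hq'⟩ := h
  obtain ⟨h1, h2⟩ := Prod.mk.inj hq'
  refine hA.eq_sectorResolvent hw h0 hρ ?_ n
  rw [← vadd_smul_id_mem_graph]
  have hq2 : q = (invShift (dGamma A) ρ Ψ, (Ψ : Fock μ)) := Prod.ext h2 h1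
  rwa [← hq2]

end Resolvent

/-! ### Comparison of Gram matrices and the Schur product theorem -/

section Gram

open Matrix
open scoped ComplexOrder

variable {ι E H : Type*} [Fintype ι] [AddCommGroup E] [Module ℂ E] [NormedAddCommGroup H]
  [InnerProductSpace ℂ H]

theorem dotProduct_mulVec_inner (S T : E →ₗ[ℂ] H) (v : ι → E) (x : ι → ℂ) :
    star x ⬝ᵥ (Matrix.of fun m m' => inner ℂ (S (v m)) (T (v m'))) *ᵥ x =
      inner ℂ (S (∑ m, x m • v m)) (T (∑ m, x m • v m)) := by
  simp only [dotProduct, mulVec, map_sum, map_smul, sum_inner, inner_sum, inner_smul_left,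
    inner_smul_right, Matrix.of_apply, Pi.star_apply, Finset.mul_sum]
  rw [Finset.sum_comm]
  refine Finset.sum_congr rfl fun m _ => Finset.sum_congr rfl fun m' _ => ?_
  simp only [RCLike.star_def]
  ring

theorem re_inner_self_nonneg (x : H) : 0 ≤ (inner ℂ x x).re :=
  inner_self_nonneg (𝕜 := ℂ)

/-- The quadratic form of the matrix at `x` is `⟨S e, T e⟩` for the single vector `e = ∑ x m • v m`;
symmetry makes it real. -/
theorem posSemidef_inner {S T : E →ₗ[ℂ] H} (hsymm : ∀ e e', inner ℂ (S e) (T e') = inner ℂ (T e) (S e'))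
    (hpos : ∀ e, 0 ≤ (inner ℂ (S e) (T e)).re) (v : ι → E) :
    (Matrix.of fun m m' => inner ℂ (S (v m)) (T (v m'))).PosSemidef := by
  rw [posSemidef_iff_dotProduct_mulVec]
  refine ⟨?_, fun x => ?_⟩
  · ext m m'
    simp only [conjTranspose_apply, Matrix.of_apply, RCLike.star_def, inner_conj_symm]
    exact (hsymm _ _).symm
  · rw [dotProduct_mulVec_inner, Complex.le_def]
    refine ⟨hpos _, ?_⟩
    have h : (starRingEnd ℂ) (inner ℂ (S (∑ m, x m • v m)) (T (∑ m, x m • v m))) =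
        inner ℂ (S (∑ m, x m • v m)) (T (∑ m, x m • v m)) := by
      rw [inner_conj_symm]
      exact (hsymm _ _).symm
    exact (Complex.conj_eq_iff_im.1 h).symm

theorem posSemidef_sub_inner {S T P R : E →ₗ[ℂ] H} {c : ℝ}
    (h1 : ∀ e e', inner ℂ (S e) (T e') = inner ℂ (T e) (S e'))
    (h2 : ∀ e e', inner ℂ (P e) (R e') = inner ℂ (R e) (P e'))
    (hle : ∀ e, (inner ℂ (S e) (T e)).re ≤ c * (inner ℂ (P e) (R e)).re) (v : ι → E) :
    ((c : ℂ) • (Matrix.of fun m m' => inner ℂ (P (v m)) (R (v m'))) -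
      (Matrix.of fun m m' => inner ℂ (S (v m)) (T (v m')))).PosSemidef := by
  rw [posSemidef_iff_dotProduct_mulVec]
  have him : ∀ {S T : E →ₗ[ℂ] H}, (∀ e e', inner ℂ (S e) (T e') = inner ℂ (T e) (S e')) →
      ∀ e, (inner ℂ (S e) (T e)).im = 0 := fun {S T} h e => by
    refine Complex.conj_eq_iff_im.1 ?_
    rw [inner_conj_symm]
    exact (h _ _).symm
  refine ⟨?_, fun x => ?_⟩
  · ext m m'
    simp only [conjTranspose_apply, Matrix.sub_apply, Matrix.smul_apply, Matrix.of_apply,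
      RCLike.star_def, map_sub, smul_eq_mul, map_mul, Complex.conj_ofReal, inner_conj_symm, h1, h2]
  · rw [sub_mulVec, smul_mulVec, dotProduct_sub, dotProduct_smul, dotProduct_mulVec_inner,
      dotProduct_mulVec_inner, Complex.le_def]
    generalize ∑ m, x m • v m = e
    simp [him h1, him h2, hle]

/-- One tensor slot of a cross term. In the application `S e = U e`, `T e = a (U e)`, `P e = e`, `R
e = B e`, and `b`, `b'` tell whether the slot is hit on the left and on the right. The four cases
are `a² ≤ 4 B²`, `a ≤ 2 B` (twice) and `1 ≤ 1`: each hit costs a factor `2`. -/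
theorem posSemidef_slot {S T P R : E →ₗ[ℂ] H}
    (hSP : ∀ e e', inner ℂ (S e) (S e') = inner ℂ (P e) (P e'))
    (hST : ∀ e e', inner ℂ (S e) (T e') = inner ℂ (T e) (S e'))
    (hPR : ∀ e e', inner ℂ (P e) (R e') = inner ℂ (R e) (P e'))
    (hpos : ∀ e, 0 ≤ (inner ℂ (S e) (T e)).re)
    (hform : ∀ e, (inner ℂ (S e) (T e)).re ≤ 2 * (inner ℂ (P e) (R e)).re)
    (hnorm : ∀ e, ‖T e‖ ≤ 2 * ‖R e‖) (b b' : Prop) [Decidable b] [Decidable b'] (v : ι → E) :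
    (Matrix.of fun m m' => inner ℂ ((if b then T else S) (v m))
        ((if b' then T else S) (v m'))).PosSemidef ∧
      ((((if b then 2 else 1) * (if b' then 2 else 1) : ℝ) : ℂ) •
        (Matrix.of fun m m' => inner ℂ ((if b then R else P) (v m)) ((if b' then R else P) (v m'))) -
        (Matrix.of fun m m' => inner ℂ ((if b then T else S) (v m))
          ((if b' then T else S) (v m')))).PosSemidef := by
  have hTT : ∀ e, (inner ℂ (T e) (T e)).re ≤ (2 * 2) * (inner ℂ (R e) (R e)).re := fun e => by
    have h1 : (inner ℂ (T e) (T e)).re = ‖T e‖ ^ 2 := inner_self_eq_norm_sq (𝕜 := ℂ) _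
    have h2 : (inner ℂ (R e) (R e)).re = ‖R e‖ ^ 2 := inner_self_eq_norm_sq (𝕜 := ℂ) _
    rw [h1, h2]
    nlinarith [hnorm e, norm_nonneg (T e), norm_nonneg (R e)]
  have hTS : ∀ e, (inner ℂ (T e) (S e)).re ≤ (2 * 1) * (inner ℂ (R e) (P e)).re := fun e => by
    rw [← hST, ← hPR, mul_one]; exact hform e
  have hST' : ∀ e, (inner ℂ (S e) (T e)).re ≤ (1 * 2) * (inner ℂ (P e) (R e)).re := fun e => by
    rw [one_mul]; exact hform e
  have hSS : ∀ e, (inner ℂ (S e) (S e)).re ≤ (1 * 1) * (inner ℂ (P e) (P e)).re := fun e => by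
    rw [hSP, one_mul, one_mul]
  by_cases h1 : b <;> by_cases h2 : b'
  · simp only [if_pos h1, if_pos h2]
    exact ⟨posSemidef_inner (fun _ _ => rfl) (fun e => re_inner_self_nonneg _) v,
      posSemidef_sub_inner (fun _ _ => rfl) (fun _ _ => rfl) hTT v⟩
  · simp only [if_pos h1, if_neg h2]
    exact ⟨posSemidef_inner (fun e e' => (hST e e').symm) (fun e => by rw [← hST]; exact hpos e) v,
      posSemidef_sub_inner (fun e e' => (hST e e').symm) (fun e e' => (hPR e e').symm) hTS v⟩
  · simp only [if_neg h1, if_pos h2]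
    exact ⟨posSemidef_inner hST hpos v, posSemidef_sub_inner hST hPR hST' v⟩
  · simp only [if_neg h1, if_neg h2]
    exact ⟨posSemidef_inner (fun _ _ => rfl) (fun e => re_inner_self_nonneg _) v,
      posSemidef_sub_inner (fun _ _ => rfl) (fun _ _ => rfl) hSS v⟩

/-- Induction through `B ⊙ B' - A ⊙ A' = B ⊙ (B' - A') + (B - A) ⊙ A'` and the Schur product
theorem, where `B = (B - A) + A` is positive. It plays the part of monotonicity of tensor products
of positive operators. -/
theorem posSemidef_prod_sub_prod {κ : Type*} (s : Finset κ) {A B : κ → Matrix ι ι ℂ}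
    (hA : ∀ l ∈ s, (A l).PosSemidef) (hAB : ∀ l ∈ s, (B l - A l).PosSemidef) :
    (Matrix.of fun m m' => ∏ l ∈ s, A l m m').PosSemidef ∧
      ((Matrix.of fun m m' => ∏ l ∈ s, B l m m') -
        (Matrix.of fun m m' => ∏ l ∈ s, A l m m')).PosSemidef := by
  classical
  induction s using Finset.induction_on with
  | empty =>
    refine ⟨?_, by simpa using PosSemidef.zero⟩
    have := posSemidef_inner (S := (LinearMap.id : ℂ →ₗ[ℂ] ℂ)) (T := LinearMap.id)
      (fun _ _ => rfl) (fun e => re_inner_self_nonneg _) (fun _ : ι => (1 : ℂ))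
    simpa using this
  | insert l s hl ih =>
    obtain ⟨ih1, ih2⟩ := ih (fun k hk => hA k (Finset.mem_insert_of_mem hk))
      (fun k hk => hAB k (Finset.mem_insert_of_mem hk))
    have a1 := hA l (Finset.mem_insert_self l s)
    have a2 := hAB l (Finset.mem_insert_self l s)
    constructor
    · have h : (Matrix.of fun m m' => ∏ k ∈ insert l s, A k m m') =
          A l ⊙ Matrix.of fun m m' => ∏ k ∈ s, A k m m' := by
        ext m m'
        simp [Finset.prod_insert hl]
      rw [h]
      exact a1.hadamard ih1
    · have h := ((a2.add a1).hadamard ih2).add (a2.hadamard ih1)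
      refine (congrArg Matrix.PosSemidef ?_).mp h
      ext m m'
      simp only [Finset.prod_insert hl, Matrix.sub_apply, Matrix.add_apply, Matrix.of_apply,
        hadamard_apply]
      ring

end Gram

/-! ### Norm comparison for sums of one-particle operators -/

section SumOfTensors

open Matrix
open scoped ComplexOrder

variable {X : Type*} [MeasurableSpace X] {μ : Measure X} [SigmaFinite μ] {n : ℕ}
  {ι E : Type*} [Fintype ι] [AddCommGroup E] [Module ℂ E]

theorem norm_sq_sum_tensor_update (S T : E →ₗ[ℂ] Lp ℂ 2 μ) (c : ι → ℂ) (f : ι → Fin n → E) :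
    ((‖∑ m, c m • ∑ j, tensor (Function.update (fun i => S (f m i)) j (T (f m j)))‖ ^ 2 : ℝ) : ℂ) =
      ∑ j : Fin n, ∑ j' : Fin n, star c ⬝ᵥ (Matrix.of fun m m' => ∏ l : Fin n,
        inner ℂ (Function.update (fun i => S (f m i)) j (T (f m j)) l)
          (Function.update (fun i => S (f m' i)) j' (T (f m' j')) l)) *ᵥ c := by
  have h := inner_self_eq_norm_sq_to_K (𝕜 := ℂ)
    (∑ m, c m • ∑ j, tensor (Function.update (fun i => S (f m i)) j (T (f m j))))
  rw [Complex.ofReal_pow]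
  refine h.symm.trans ?_
  simp only [sum_inner, inner_sum, inner_smul_left, inner_smul_right, inner_tensor, dotProduct,
    mulVec, Matrix.of_apply, Pi.star_apply, Finset.mul_sum, RCLike.star_def]
  have e1 : ∀ F : ι → Fin n → ι → Fin n → ℂ, ∑ m', ∑ j', ∑ m, ∑ j, F m' j' m j =
      ∑ j, ∑ j', ∑ m, ∑ m', F m' j' m j := by
    intro F
    calc ∑ m', ∑ j', ∑ m, ∑ j, F m' j' m j = ∑ j', ∑ m', ∑ m, ∑ j, F m' j' m j :=
          Finset.sum_comm
      _ = ∑ j', ∑ m', ∑ j, ∑ m, F m' j' m j :=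
          Finset.sum_congr rfl fun _ _ => Finset.sum_congr rfl fun _ _ => Finset.sum_comm
      _ = ∑ j', ∑ j, ∑ m', ∑ m, F m' j' m j :=
          Finset.sum_congr rfl fun _ _ => Finset.sum_comm
      _ = ∑ j, ∑ j', ∑ m', ∑ m, F m' j' m j := Finset.sum_comm
      _ = _ := Finset.sum_congr rfl fun _ _ => Finset.sum_congr rfl fun _ _ => Finset.sum_comm
  refine (e1 _).trans ?_
  refine Finset.sum_congr rfl fun j _ => Finset.sum_congr rfl fun j' _ =>
    Finset.sum_congr rfl fun m _ => Finset.sum_congr rfl fun m' _ => ?_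
  ring

/-- Both squared norms are sums over pairs `j, j'` of quadratic forms whose matrices are entrywise
products over the slots, so the slotwise comparison applies to each pair separately. -/
theorem norm_sum_tensor_update_le {S T P R : E →ₗ[ℂ] Lp ℂ 2 μ}
    (hSP : ∀ e e', inner ℂ (S e) (S e') = inner ℂ (P e) (P e'))
    (hST : ∀ e e', inner ℂ (S e) (T e') = inner ℂ (T e) (S e'))
    (hPR : ∀ e e', inner ℂ (P e) (R e') = inner ℂ (R e) (P e'))
    (hpos : ∀ e, 0 ≤ (inner ℂ (S e) (T e)).re)
    (hform : ∀ e, (inner ℂ (S e) (T e)).re ≤ 2 * (inner ℂ (P e) (R e)).re)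
    (hnorm : ∀ e, ‖T e‖ ≤ 2 * ‖R e‖) (c : ι → ℂ) (f : ι → Fin n → E) :
    ‖∑ m, c m • ∑ j, tensor (Function.update (fun i => S (f m i)) j (T (f m j)))‖ ≤
      2 * ‖∑ m, c m • ∑ j, tensor (Function.update (fun i => P (f m i)) j (R (f m j)))‖ := by
  suffices h : (0 : ℂ) ≤ ((2 ^ 2 *
      ‖∑ m, c m • ∑ j, tensor (Function.update (fun i => P (f m i)) j (R (f m j)))‖ ^ 2 -
      ‖∑ m, c m • ∑ j, tensor (Function.update (fun i => S (f m i)) j (T (f m j)))‖ ^ 2 : ℝ) : ℂ) by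
    have h' := sub_nonneg.1 (Complex.zero_le_real.1 h)
    rw [← mul_pow] at h'
    exact (pow_le_pow_iff_left₀ (norm_nonneg _) (by positivity) two_ne_zero).1 h'
  rw [Complex.ofReal_sub, Complex.ofReal_mul, norm_sq_sum_tensor_update, norm_sq_sum_tensor_update,
    Finset.mul_sum, ← Finset.sum_sub_distrib]
  refine Finset.sum_nonneg fun j _ => ?_
  rw [Finset.mul_sum, ← Finset.sum_sub_distrib]
  refine Finset.sum_nonneg fun j' _ => ?_
  -- The product of these constants is always `4`: one slot with factor `4` if `j = j'`, two slots
  -- with factor `2` otherwise.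
  let d : Fin n → ℝ := fun l => (if l = j then 2 else 1) * (if l = j' then 2 else 1)
  have h := (posSemidef_prod_sub_prod Finset.univ
    (fun l _ => (posSemidef_slot hSP hST hPR hpos hform hnorm (l = j) (l = j') fun m => f m l).1)
    (fun l _ => (posSemidef_slot hSP hST hPR hpos hform hnorm (l = j) (l = j') fun m => f m l).2)).2
  have hd : ∏ l, (d l : ℂ) = ((2 ^ 2 : ℝ) : ℂ) := by
    rw [← Complex.ofReal_prod, Finset.prod_mul_distrib, Finset.prod_ite_eq', Finset.prod_ite_eq']
    simp [sq]
  have h3 := h.dotProduct_mulVec_nonneg c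
  rw [sub_mulVec, dotProduct_sub] at h3
  have e1 : ∀ S T : E →ₗ[ℂ] Lp ℂ 2 μ, (Matrix.of fun m m' => ∏ l : Fin n,
        inner ℂ (Function.update (fun i => S (f m i)) j (T (f m j)) l)
          (Function.update (fun i => S (f m' i)) j' (T (f m' j')) l)) =
      Matrix.of fun m m' => ∏ l : Fin n,
        inner ℂ ((if l = j then T else S) (f m l)) ((if l = j' then T else S) (f m' l)) := by
    intro S T
    ext m m'
    simp only [Matrix.of_apply]
    refine Finset.prod_congr rfl fun l _ => ?_
    rw [Function.update_apply, Function.update_apply]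
    congr 1
    · split_ifs with h
      · rw [h]
      · rfl
    · split_ifs with h
      · rw [h]
      · rfl
  rw [e1, e1, ← smul_eq_mul, ← dotProduct_smul, ← smul_mulVec]
  refine h3.trans_eq ?_
  congr 3
  ext m m'
  simp only [Matrix.of_apply, Matrix.smul_apply, smul_eq_mul, Finset.prod_mul_distrib]
  congr 1

end SumOfTensors

/-! ### From a norm bound to a form bound -/

section FormBound

variable {H : Type*} [NormedAddCommGroup H] [InnerProductSpace ℂ H] [CompleteSpace H]

/-- `S K S` is self-adjoint, so its norm is its spectral radius. Its nonzero spectrum agrees with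
that of `K S S`, which lies in the disc of radius `‖K S S‖ ≤ c`. -/
theorem norm_mul_mul_le_of_norm_mul_le {S K : H →L[ℂ] H} (hS : IsSelfAdjoint S)
    (hK : IsSelfAdjoint K) {c : ℝ} (h : ∀ g, ‖K (S (S g))‖ ≤ c * ‖g‖) (hc : 0 ≤ c) (g : H) :
    ‖S (K (S g))‖ ≤ c * ‖g‖ := by
  rcases subsingleton_or_nontrivial H with hH | hH
  · rw [Subsingleton.elim (S (K (S g))) 0, norm_zero]
    positivity
  have hsa : IsSelfAdjoint (S * (K * S)) := by
    have := hK.conjugate_self hS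
    rwa [mul_assoc] at this
  have hn : ‖K * S * S‖ ≤ c := ContinuousLinearMap.opNorm_le_bound _ hc h
  have hr : spectralRadius ℂ (S * (K * S)) ≤ ENNReal.ofReal c := by
    refine iSup₂_le fun k hk => ?_
    by_cases hk0 : k = 0
    · simp [hk0]
    have hk' : k ∈ spectrum ℂ (K * S * S) := by
      have : k ∈ spectrum ℂ (S * (K * S)) \ {0} := ⟨hk, hk0⟩
      rw [spectrum.nonzero_mul_comm] at this
      exact this.1
    have := (spectrum.norm_le_norm_of_mem hk').trans hn
    rw [← ENNReal.ofReal_coe_nnreal, coe_nnnorm]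
    exact ENNReal.ofReal_le_ofReal this
  rw [hsa.spectralRadius_eq_nnnorm, ← ENNReal.ofReal_coe_nnreal, coe_nnnorm,
    ENNReal.ofReal_le_ofReal_iff hc] at hr
  exact (ContinuousLinearMap.le_opNorm (S * (K * S)) g).trans
    (mul_le_mul_of_nonneg_right hr (norm_nonneg g))

end FormBound

/-! ### Real multipliers and the square root of an operator inequality -/

section RealMul

variable {X : Type*} [MeasurableSpace X] {μ : Measure X}

theorem inner_boundedMul_real {m : X → ℝ} (hm : Measurable fun x => (m x : ℂ)) {C : ℝ}
    (hC : ∀ x, ‖(m x : ℂ)‖ ≤ C) (f g : Lp ℂ 2 μ) :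
    inner ℂ f (boundedMul μ hm hC g) = inner ℂ (boundedMul μ hm hC f) g := by
  rw [L2.inner_def, L2.inner_def]
  refine integral_congr_ae ?_
  filter_upwards [boundedMul_ae hm hC f, boundedMul_ae hm hC g] with x h1 h2
  rw [h1, h2]
  simp
  ring

theorem isSelfAdjoint_boundedMul_real {m : X → ℝ} (hm : Measurable fun x => (m x : ℂ)) {C : ℝ}
    (hC : ∀ x, ‖(m x : ℂ)‖ ≤ C) : IsSelfAdjoint (boundedMul μ hm hC) :=
  ContinuousLinearMap.isSelfAdjoint_iff_isSymmetric.2 fun f g =>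
    (inner_boundedMul_real hm hC f g).symm

theorem re_inner_nonneg_of_ae {f g : Lp ℂ 2 μ} {m : X → ℝ} (hm : ∀ x, 0 ≤ m x)
    (h : g =ᵐ[μ] fun x => (m x : ℂ) * f x) : 0 ≤ (inner ℂ f g).re := by
  rw [L2.inner_def]
  change 0 ≤ RCLike.re (K := ℂ) _
  rw [← integral_re (L2.integrable_inner f g)]
  refine integral_nonneg_of_ae ?_
  filter_upwards [h] with x hx
  rw [hx, Pi.zero_apply, ← smul_eq_mul, inner_smul_right]
  have h2 : inner ℂ (f x) (f x) = ((‖f x‖ ^ 2 : ℝ) : ℂ) := by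
    rw [inner_self_eq_norm_sq_to_K]; norm_cast
  rw [h2, ← Complex.ofReal_mul]
  exact mul_nonneg (hm x) (sq_nonneg _)

/-- Put `K = U⁻¹ a U` and `S = (v + δ)^(-1/2)`. The hypothesis gives `‖K S² y‖ ≤ 2 ‖v (v + δ)⁻¹ y‖ ≤
2 ‖y‖`, hence `‖S K S‖ ≤ 2`. Testing this on `y = (v + δ)^(1/2) f` gives `⟨f, K f⟩ ≤ 2 ⟨f, (v + δ)
f⟩`, and `δ → 0` finishes. -/
theorem re_inner_le_of_norm_le {U : Lp ℂ 2 μ ≃ₗᵢ[ℂ] Lp ℂ 2 μ} {v a : X → ℝ} (hv : Measurable v)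
    (hv0 : ∀ x, 0 ≤ v x) (ha : Measurable fun x => (a x : ℂ)) {C : ℝ} (hC : ∀ x, ‖(a x : ℂ)‖ ≤ C)
    (h : ∀ f g : Lp ℂ 2 μ, g =ᵐ[μ] (fun x => (v x : ℂ) * f x) →
      ‖boundedMul μ ha hC (U f)‖ ≤ 2 * ‖g‖)
    {f g : Lp ℂ 2 μ} (hfg : g =ᵐ[μ] fun x => (v x : ℂ) * f x) :
    (inner ℂ (U f) (boundedMul μ ha hC (U f))).re ≤ 2 * (inner ℂ f g).re := by
  have key : ∀ δ : ℝ, 0 < δ → (inner ℂ (U f) (boundedMul μ ha hC (U f))).re ≤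
      2 * ((inner ℂ f g).re + δ * ‖f‖ ^ 2) := by
    intro δ hδ
    have hpos : ∀ x, 0 < v x + δ := fun x => by linarith [hv0 x]
    have hs : Measurable fun x => (((Real.sqrt (v x + δ))⁻¹ : ℝ) : ℂ) := by fun_prop
    have hs1 : ∀ x, ‖(((Real.sqrt (v x + δ))⁻¹ : ℝ) : ℂ)‖ ≤ (Real.sqrt δ)⁻¹ := fun x => by
      rw [Complex.norm_real, Real.norm_of_nonneg (by positivity)]
      exact inv_anti₀ (Real.sqrt_pos.2 hδ) (Real.sqrt_le_sqrt (by linarith [hv0 x]))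
    have hr : Measurable fun x => ((v x / (v x + δ) : ℝ) : ℂ) := by fun_prop
    have hr1 : ∀ x, ‖((v x / (v x + δ) : ℝ) : ℂ)‖ ≤ 1 := fun x => by
      rw [Complex.norm_real, Real.norm_of_nonneg (div_nonneg (hv0 x) (hpos x).le),
        div_le_one (hpos x)]
      linarith
    let S := boundedMul μ hs hs1
    let K : Lp ℂ 2 μ →L[ℂ] Lp ℂ 2 μ :=
      U.symm.toContinuousLinearEquiv.toContinuousLinearMap ∘L boundedMul μ ha hC ∘L
        U.toContinuousLinearEquiv.toContinuousLinearMap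
    have hKi : ∀ x y, inner ℂ x (K y) = inner ℂ (U x) (boundedMul μ ha hC (U y)) := fun x y => by
      rw [← U.inner_map_map]
      change inner ℂ (U x) (U (U.symm _)) = _
      rw [U.apply_symm_apply]
      rfl
    have hKn : ∀ x, ‖K x‖ = ‖boundedMul μ ha hC (U x)‖ := fun x => U.symm.norm_map _
    have hK : IsSelfAdjoint K := ContinuousLinearMap.isSelfAdjoint_iff_isSymmetric.2 fun x y => by
      change inner ℂ (K x) y = inner ℂ x (K y)
      rw [hKi, ← inner_conj_symm, hKi, inner_conj_symm]
      exact (inner_boundedMul_real ha hC _ _).symm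
    have hb : ∀ y, ‖S (K (S y))‖ ≤ 2 * ‖y‖ := by
      refine norm_mul_mul_le_of_norm_mul_le (isSelfAdjoint_boundedMul_real hs hs1) hK (fun y => ?_)
        zero_le_two
      rw [hKn]
      have hle : ‖boundedMul μ hr hr1 y‖ ≤ ‖y‖ :=
        (norm_boundedMul_apply_le hr hr1 y).trans_eq (one_mul _)
      refine (h (S (S y)) (boundedMul μ hr hr1 y) ?_).trans (by linarith)
      filter_upwards [boundedMul_ae hr hr1 y, boundedMul_ae hs hs1 (S y), boundedMul_ae hs hs1 y]
        with x h1 h2 h3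
      rw [h1, h2, h3, ← mul_assoc, ← mul_assoc, ← Complex.ofReal_mul, ← Complex.ofReal_mul]
      congr 2
      rw [mul_assoc, ← mul_inv, Real.mul_self_sqrt (hpos x).le, div_eq_mul_inv]
    -- Square integrable since `√(v + δ) ≤ v + δ + 1` and both `f` and `v f = g` are in `L²`.
    have hy : MemLp (fun x => ((Real.sqrt (v x + δ) : ℝ) : ℂ) * f x) 2 μ := by
      have hm : Measurable fun x => ((Real.sqrt (v x + δ) : ℝ) : ℂ) := by fun_prop
      have h1 := ((Lp.memLp g).add ((Lp.memLp f).const_smul ((δ : ℂ) + 1)))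
      refine h1.mono (hm.aestronglyMeasurable.mul (Lp.aestronglyMeasurable f)) ?_
      filter_upwards [hfg] with x hx
      rw [Pi.add_apply, Pi.smul_apply, hx, smul_eq_mul, ← add_mul, norm_mul, norm_mul]
      refine mul_le_mul_of_nonneg_right ?_ (norm_nonneg _)
      have h2 : ((v x : ℂ) + ((δ : ℂ) + 1)) = ((v x + δ + 1 : ℝ) : ℂ) := by push_cast; ring
      rw [h2, Complex.norm_real, Complex.norm_real, Real.norm_of_nonneg (Real.sqrt_nonneg _),
        Real.norm_of_nonneg (by linarith [hv0 x])]
      refine Real.sqrt_le_iff.2 ⟨by linarith [hv0 x], ?_⟩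
      nlinarith [hpos x]
    set y := hy.toLp _
    have hyae : y =ᵐ[μ] fun x => ((Real.sqrt (v x + δ) : ℝ) : ℂ) * f x := hy.coeFn_toLp
    have hSy : S y = f := by
      refine Lp.ext ?_
      filter_upwards [boundedMul_ae hs hs1 y, hyae] with x h1 h2
      rw [h1, h2, ← mul_assoc, ← Complex.ofReal_mul,
        inv_mul_cancel₀ (Real.sqrt_pos.2 (hpos x)).ne', Complex.ofReal_one, one_mul]
    have hyn : ‖y‖ ^ 2 = (inner ℂ f g).re + δ * ‖f‖ ^ 2 := by
      have h1 : inner ℂ y y = inner ℂ f (g + (δ : ℂ) • f) := by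
        rw [L2.inner_def, L2.inner_def]
        refine integral_congr_ae ?_
        filter_upwards [hyae, hfg, Lp.coeFn_add g ((δ : ℂ) • f), Lp.coeFn_smul (δ : ℂ) f]
          with x h1 h2 h3 h4
        rw [h1, h3, Pi.add_apply, h4, Pi.smul_apply, h2, smul_eq_mul, ← add_mul, ← smul_eq_mul,
          ← smul_eq_mul, inner_smul_left, inner_smul_right, inner_smul_right, ← mul_assoc,
          Complex.conj_ofReal, ← Complex.ofReal_mul, ← Complex.ofReal_add,
          Real.mul_self_sqrt (hpos x).le]
      rw [inner_add_right, inner_smul_right, inner_self_eq_norm_sq_to_K,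
        inner_self_eq_norm_sq_to_K] at h1
      have h2 := congrArg Complex.re h1
      simpa [← Complex.ofReal_pow] using h2
    have h1 : inner ℂ (U f) (boundedMul μ ha hC (U f)) = inner ℂ y (S (K (S y))) := by
      rw [← hKi, inner_boundedMul_real hs hs1]
      change _ = inner ℂ (S y) (K (S y))
      rw [hSy]
    rw [h1, ← hyn]
    refine ((Complex.re_le_norm _).trans (norm_inner_le_norm _ _)).trans ?_
    nlinarith [hb y, norm_nonneg y]
  refine le_of_forall_pos_le_add fun ε hε => ?_
  have hf : 0 < 2 * (‖f‖ ^ 2 + 1) := by positivity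
  -- This `δ` makes the error `2 δ ‖f‖²` at most `ε`; the `+ 1` covers `f = 0`.
  refine (key (ε / (2 * (‖f‖ ^ 2 + 1))) (by positivity)).trans ?_
  have : ε / (2 * (‖f‖ ^ 2 + 1)) * ‖f‖ ^ 2 ≤ ε / 2 := by
    rw [div_mul_eq_mul_div, div_le_div_iff₀ hf two_pos]
    nlinarith [sq_nonneg ‖f‖]
  linarith

end RealMul

/-! ### The estimate in the `n`-particle sector -/

section SectorBound

variable {X : Type*} [MeasurableSpace X] {μ : Measure X} [SigmaFinite μ] {n : ℕ}
  {B : Lp ℂ 2 μ →ₗ.[ℂ] Lp ℂ 2 μ} {U : Lp ℂ 2 μ ≃ₗᵢ[ℂ] Lp ℂ 2 μ}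

theorem norm_sum_le_real {X : Type*} {n : ℕ} {a : X → ℝ} {C : ℝ} (hC : ∀ x, ‖(a x : ℂ)‖ ≤ C) (x : Fin n → X) :
    ‖∑ j, (a (x j) : ℂ)‖ ≤ n * C := by
  refine (norm_sum_le_of_le Finset.univ (n := fun _ => C) fun j _ => hC (x j)).trans ?_
  simp

/-- The multiplier is bounded, so the inequality is closed in `p` and need only be checked on finite
sums of product vectors. -/
theorem norm_sum_mul_le_of_mem_closure
    (hB : ∀ f g : B.domain, inner ℂ (f : Lp ℂ 2 μ) (B g) = inner ℂ (B f) (g : Lp ℂ 2 μ))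
    {a : X → ℝ} (ha : Measurable fun x => (a x : ℂ)) {C : ℝ} (hC : ∀ x, ‖(a x : ℂ)‖ ≤ C)
    (ha0 : ∀ x, 0 ≤ a x)
    (hnorm : ∀ f : B.domain, ‖boundedMul μ ha hC (U f)‖ ≤ 2 * ‖B f‖)
    (hform : ∀ f : B.domain, (inner ℂ (U f) (boundedMul μ ha hC (U f))).re ≤
      2 * (inner ℂ (f : Lp ℂ 2 μ) (B f)).re)
    {p : Lp ℂ 2 (Measure.pi fun _ : Fin n => μ) × Lp ℂ 2 (Measure.pi fun _ : Fin n => μ)}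
    (hp : p ∈ (tensorGraph B n).topologicalClosure) :
    ‖boundedMul _ (measurable_sum_eval ha) (norm_sum_le_real hC) (tensorPower n U p.1)‖ ≤
      2 * ‖p.2‖ := by
  have hcl : IsClosed {p : Lp ℂ 2 (Measure.pi fun _ : Fin n => μ) ×
      Lp ℂ 2 (Measure.pi fun _ : Fin n => μ) |
      ‖boundedMul _ (measurable_sum_eval ha) (norm_sum_le_real hC) (tensorPower n U p.1)‖ ≤
      2 * ‖p.2‖} := by
    refine isClosed_le ?_ (by fun_prop)
    exact ((boundedMul _ (measurable_sum_eval ha) (norm_sum_le_real hC)).continuous.comp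
      ((tensorPower n U).continuous.comp continuous_fst)).norm
  refine closure_minimal (fun q hq => ?_) hcl hp
  obtain ⟨N, c, g, rfl⟩ := Submodule.mem_span_set'.1 hq
  choose f hf1 hf2 using fun m => (g m).2
  let S : B.domain →ₗ[ℂ] Lp ℂ 2 μ := U.toLinearEquiv.toLinearMap ∘ₗ B.domain.subtype
  have h := norm_sum_tensor_update_le (n := n) (S := S)
    (T := (boundedMul μ ha hC : Lp ℂ 2 μ →ₗ[ℂ] Lp ℂ 2 μ) ∘ₗ S)
    (P := B.domain.subtype) (R := B.toFun)
    (fun e e' => U.inner_map_map _ _) (fun e e' => inner_boundedMul_real ha hC _ _) hB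
    (fun e => re_inner_nonneg_of_ae ha0 (boundedMul_ae ha hC _)) hform hnorm c f
  refine le_of_eq_of_le ?_ (h.trans_eq ?_)
  · congr 1
    rw [Prod.fst_sum, map_sum, map_sum]
    refine Finset.sum_congr rfl fun m _ => ?_
    rw [Prod.smul_fst, map_smul, map_smul, hf1, tensorPower_tensor]
    congr 1
    refine Lp.ext ?_
    exact (boundedMul_ae _ _ _).trans (sum_tensor_update_ae (w := fun x => (a x : ℂ))
      fun j => boundedMul_ae ha hC _).symm
  · congr 2
    rw [Prod.snd_sum]
    refine Finset.sum_congr rfl fun m _ => ?_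
    rw [Prod.smul_snd, hf2]
    rfl

/-- Cauchy–Schwarz in the form `n² ≤ (∑ a) (∑ a⁻¹)`, where the `n` shares `ρ / n` in the bounds on
`a⁻¹` add up to `ρ`. -/
theorem sq_div_le_sum {X : Type*} {n : ℕ} {a w : X → ℝ} {ρ : ℝ} (hρ : 0 < ρ) (ha : ∀ x, 0 < a x) (hw : ∀ x, 0 ≤ w x)
    (haw : ∀ x, (a x)⁻¹ ≤ w x + ρ / n) (x : Fin n → X) :
    (n : ℝ) ^ 2 * ((∑ j, w (x j)) + ρ)⁻¹ ≤ ∑ j, a (x j) := by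
  have hs : 0 ≤ ∑ j, w (x j) := Finset.sum_nonneg fun j _ => hw _
  rcases Nat.eq_zero_or_pos n with hn | hn
  · subst hn; simp
  have h1 : ∑ j, (a (x j))⁻¹ ≤ (∑ j, w (x j)) + ρ := by
    refine (Finset.sum_le_sum fun j _ => haw (x j)).trans_eq ?_
    rw [Finset.sum_add_distrib, Finset.sum_const, Finset.card_univ, Fintype.card_fin, nsmul_eq_mul]
    field_simp
  have h2 := Finset.sum_sq_le_sum_mul_sum_of_sq_le_mul (Finset.univ : Finset (Fin n))
    (r := fun _ => (1 : ℝ)) (f := fun j => a (x j)) (g := fun j => (a (x j))⁻¹)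
    (fun j _ => (ha _).le) (fun j _ => (inv_pos.2 (ha _)).le)
    (fun j _ => by rw [one_pow, mul_inv_cancel₀ (ha _).ne'])
  simp only [Finset.sum_const, Finset.card_univ, Fintype.card_fin, nsmul_eq_mul, mul_one] at h2
  rw [← div_eq_mul_inv, div_le_iff₀ (by linarith)]
  exact h2.trans (mul_le_mul_of_nonneg_left h1 (Finset.sum_nonneg fun j _ => (ha _).le))

theorem norm_sq_smul_sectorResolvent_le
    (hB : ∀ f g : B.domain, inner ℂ (f : Lp ℂ 2 μ) (B g) = inner ℂ (B f) (g : Lp ℂ 2 μ))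
    {w : X → ℝ} (hw : Measurable w) (h0 : ∀ x, 0 ≤ w x) {ρ : ℝ} (hρ : 0 < ρ)
    {a : X → ℝ} (ha : Measurable fun x => (a x : ℂ)) {C : ℝ} (hC : ∀ x, ‖(a x : ℂ)‖ ≤ C)
    (ha0 : ∀ x, 0 < a x) (haw : ∀ x, (a x)⁻¹ ≤ w x + ρ / n)
    (hnorm : ∀ f : B.domain, ‖boundedMul μ ha hC (U f)‖ ≤ 2 * ‖B f‖)
    (hform : ∀ f : B.domain, (inner ℂ (U f) (boundedMul μ ha hC (U f))).re ≤
      2 * (inner ℂ (f : Lp ℂ 2 μ) (B f)).re)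
    {u v : symSector μ n} (hp : ((u : Lp ℂ 2 (Measure.pi fun _ : Fin n => μ)),
      (v : Lp ℂ 2 (Measure.pi fun _ : Fin n => μ))) ∈ (tensorGraph B n).topologicalClosure) :
    ‖((n : ℂ) ^ 2) • sectorResolvent U hw h0 hρ n u‖ ≤ 2 * ‖v‖ := by
  have h := norm_sum_mul_le_of_mem_closure (U := U) hB ha hC (fun x => (ha0 x).le) hnorm hform hp
  refine le_trans ?_ h
  clear h
  rw [norm_smul]
  refine (mul_le_mul_of_nonneg_left (norm_sectorResolvent_le' hw h0 hρ u) (norm_nonneg _)).trans ?_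
  rw [← norm_smul]
  refine Lp.norm_le_norm_of_ae_le ?_
  filter_upwards [boundedMul_ae (measurable_resolventMultiplier hw ρ n)
      (norm_resolventMultiplier_le h0 hρ n) (tensorPower n U u),
    boundedMul_ae (measurable_sum_eval ha) (norm_sum_le_real hC) (tensorPower n U u),
    Lp.coeFn_smul ((n : ℂ) ^ 2) (boundedMul _ (measurable_resolventMultiplier hw ρ n)
      (norm_resolventMultiplier_le h0 hρ n) (tensorPower n U u))] with x h1 h2 h3
  rw [h3, Pi.smul_apply, h1, h2, smul_eq_mul, ← mul_assoc, norm_mul, norm_mul _ (tensorPower n U u x)]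
  refine mul_le_mul_of_nonneg_right ?_ (norm_nonneg _)
  have e1 : (n : ℂ) ^ 2 * resolventMultiplier w ρ n x =
      (((n : ℝ) ^ 2 * ((∑ j, w (x j)) + ρ)⁻¹ : ℝ) : ℂ) := by
    rw [resolventMultiplier]; push_cast; rfl
  have hs : 0 ≤ ∑ j, w (x j) := Finset.sum_nonneg fun j _ => h0 _
  rw [e1, ← Complex.ofReal_sum, Complex.norm_real, Complex.norm_real,
    Real.norm_of_nonneg (by positivity), Real.norm_of_nonneg (Finset.sum_nonneg fun j _ => (ha0 _).le)]
  exact sq_div_le_sum hρ ha0 h0 haw x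

end SectorBound

/-! ### One-photon space: components, Fourier transform, a core for `|k|` -/

section Photon

theorem component_ae (l : Fin 2) (f : OnePhoton) :
    component l f =ᵐ[volume] fun k => f (k, l) :=
  (memLp_slice f l).coeFn_toLp

theorem ae_photon_of_slices {P : R3 × Fin 2 → Prop} (h : ∀ l, ∀ᵐ k : R3, P (k, l)) :
    ∀ᵐ p ∂photonMeasure, P p := by
  rw [ae_iff]
  refine measure_mono_null (t := ⋃ l : Fin 2, {k | ¬ P (k, l)} ×ˢ Set.univ) ?_ ?_
  · rintro ⟨k, l⟩ hk
    exact Set.mem_iUnion.2 ⟨l, hk, trivial⟩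
  · refine measure_iUnion_null fun l => ?_
    rw [Measure.prod_prod, ae_iff.1 (h l), zero_mul]

theorem ae_component_iff {f g : OnePhoton} {m : R3 × Fin 2 → ℂ} :
    (g =ᵐ[photonMeasure] fun p => m p * f p) ↔
      ∀ l, component l g =ᵐ[volume] fun k => m (k, l) * component l f k := by
  constructor
  · intro h l
    filter_upwards [component_ae l g, component_ae l f, ae_slice h l] with k h1 h2 h3
    rw [h1, h2, h3]
  · intro h
    refine ae_photon_of_slices fun l => ?_
    filter_upwards [component_ae l g, component_ae l f, h l] with k h1 h2 h3
    rw [← h1, ← h2, h3]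

theorem component_ext {f g : OnePhoton} (h : ∀ l, component l f = component l g) : f = g := by
  refine Lp.ext (ae_photon_of_slices fun l => ?_)
  filter_upwards [component_ae l f, component_ae l g] with k h1 h2
  rw [← h1, ← h2, h l]

theorem norm_sq_eq_sum_component (f : OnePhoton) : ‖f‖ ^ 2 = ∑ l, ‖component l f‖ ^ 2 := by
  have hn : ∀ {α : Type} {mα : MeasurableSpace α} {μ : Measure α} (g : Lp ℂ 2 μ),
      ‖g‖ ^ 2 = ∫ x, ‖g x‖ ^ 2 ∂μ := fun {α mα μ} g => by
    rw [← inner_self_eq_norm_sq (𝕜 := ℂ), L2.inner_def, ← integral_re (L2.integrable_inner g g)]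
    simp_rw [inner_self_eq_norm_sq]
  have hint : Integrable (fun p => ‖f p‖ ^ 2) photonMeasure :=
    (memLp_two_iff_integrable_sq_norm (Lp.aestronglyMeasurable f)).1 (Lp.memLp f)
  rw [hn, integral_prod_symm _ hint, integral_count]
  refine Finset.sum_congr rfl fun l _ => ?_
  rw [hn]
  refine integral_congr_ae ?_
  filter_upwards [component_ae l f] with k hk
  rw [hk]

theorem memLp_inject (l : Fin 2) (φ : Lp ℂ 2 (volume : Measure R3)) :
    MemLp (Set.indicator {p : R3 × Fin 2 | p.2 = l} fun p => φ p.1) 2 photonMeasure := by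
  refine MemLp.indicator ?_ ((Lp.memLp φ).comp_fst Measure.count)
  exact measurable_snd (measurableSet_singleton l)

/-- The one-photon vector with polarization component `φ` at `l` and `0` elsewhere. -/
def inject (l : Fin 2) (φ : Lp ℂ 2 (volume : Measure R3)) : OnePhoton := (memLp_inject l φ).toLp _

theorem component_inject (l l' : Fin 2) (φ : Lp ℂ 2 (volume : Measure R3)) :
    component l' (inject l φ) = if l' = l then φ else 0 := by
  refine Lp.ext ?_
  have h := ae_slice (memLp_inject l φ).coeFn_toLp l'
  split_ifs with hl
  · filter_upwards [component_ae l' (inject l φ), h] with k h1 h2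
    rw [h1]
    exact h2.trans (Set.indicator_of_mem (s := {p : R3 × Fin 2 | p.2 = l}) (a := (k, l')) hl _)
  · filter_upwards [component_ae l' (inject l φ), h, Lp.coeFn_zero ℂ 2 (volume : Measure R3)]
      with k h1 h2 h3
    rw [h1, h3]
    exact h2.trans (Set.indicator_of_notMem (s := {p : R3 × Fin 2 | p.2 = l}) (a := (k, l')) hl _)

theorem component_sum_inject (l : Fin 2) (g : Fin 2 → Lp ℂ 2 (volume : Measure R3)) :
    component l (∑ l', inject l' (g l')) = g l := by
  rw [map_sum]
  simp_rw [component_inject]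
  simp

theorem sum_inject_component (f : OnePhoton) : ∑ l, inject l (component l f) = f :=
  component_ext fun l => component_sum_inject l fun l => component l f

/-- The unitary Fourier transform in each polarization component. -/
def fourierPhoton : OnePhoton ≃ₗᵢ[ℂ] OnePhoton where
  toFun f := ∑ l, inject l (𝓕 (component l f))
  invFun f := ∑ l, inject l (𝓕⁻ (component l f))
  map_add' f g := component_ext fun l => by
    rw [map_add, component_sum_inject, component_sum_inject, component_sum_inject, map_add,
      FourierTransform.fourier_add]
  map_smul' c f := component_ext fun l => by
    rw [RingHom.id_apply, map_smul, component_sum_inject, component_sum_inject, map_smul,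
      FourierTransform.fourier_smul]
  left_inv f := component_ext fun l => by
    rw [component_sum_inject, component_sum_inject, FourierTransform.fourierInv_fourier_eq]
  right_inv f := component_ext fun l => by
    rw [component_sum_inject, component_sum_inject, FourierTransform.fourier_fourierInv_eq]
  norm_map' f := by
    change ‖∑ l, inject l (𝓕 (component l f))‖ = ‖f‖
    rw [← sq_eq_sq₀ (norm_nonneg _) (norm_nonneg _), norm_sq_eq_sum_component,
      norm_sq_eq_sum_component f]
    refine Finset.sum_congr rfl fun l _ => ?_
    rw [component_sum_inject, Lp.norm_fourier_eq]

theorem component_fourierPhoton (l : Fin 2) (f : OnePhoton) :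
    component l (fourierPhoton f) = 𝓕 (component l f) :=
  component_sum_inject l fun l => 𝓕 (component l f)

theorem mem_absGradGraph_iff {f g : OnePhoton} : (f, g) ∈ absGradGraph ↔
    fourierPhoton g =ᵐ[photonMeasure]
      fun p => ((2 * Real.pi * ‖p.1‖ : ℝ) : ℂ) * fourierPhoton f p := by
  rw [ae_component_iff]
  simp_rw [component_fourierPhoton]
  rfl

theorem isDiagonalizedBy_absGrad :
    IsDiagonalizedBy absGrad fourierPhoton fun p => 2 * Real.pi * ‖p.1‖ := by
  intro f g
  rw [absGrad, Submodule.toLinearPMap_graph_eq, mem_absGradGraph_iff]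
  rintro ⟨u, v⟩ h h0
  rw [mem_absGradGraph_iff] at h
  change u = 0 at h0
  change v = 0
  rw [h0, map_zero] at h
  rw [← fourierPhoton.map_eq_zero_iff, Lp.eq_zero_iff_ae_eq_zero]
  filter_upwards [h, Lp.coeFn_zero ℂ 2 photonMeasure] with p h1 h2
  rw [h1, h2]
  simp

theorem isDiagonalizedBy_absK :
    IsDiagonalizedBy absK (LinearIsometryEquiv.refl ℂ OnePhoton) fun p => ‖p.1‖ :=
  fun _ _ => mem_mulOp_graph

theorem absK_ae (f : absK.domain) :
    absK f =ᵐ[photonMeasure] fun p => ((‖p.1‖ : ℝ) : ℂ) * (f : OnePhoton) p :=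
  (isDiagonalizedBy_absK _ _).1 (absK.mem_graph f)

/-- Embedding one polarization is an isometry, so density of smooth compactly supported functions in
`L²(ℝ³)` carries over. -/
theorem inject_mem_closure_testFunctions (l : Fin 2) (φ : Lp ℂ 2 (volume : Measure R3)) :
    inject l φ ∈ testFunctions.topologicalClosure := by
  have hsub : ∀ φ ψ, inject l φ - inject l ψ = inject l (φ - ψ) := fun φ ψ =>
    component_ext fun l' => by
      rw [map_sub, component_inject, component_inject, component_inject]
      split_ifs <;> simp
  have hnorm : ∀ φ, ‖inject l φ‖ = ‖φ‖ := fun φ => by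
    rw [← sq_eq_sq₀ (norm_nonneg _) (norm_nonneg _), norm_sq_eq_sum_component]
    simp_rw [component_inject]
    rw [Finset.sum_eq_single l]
    · simp
    · intro l' _ h; simp [h]
    · simp
  have hcont : Continuous (inject l) := by
    refine (Isometry.of_dist_eq fun φ ψ => ?_).continuous
    rw [dist_eq_norm, dist_eq_norm, hsub, hnorm]
  refine map_mem_closure hcont (Lp.dense_hasCompactSupport_contDiff (F := ℂ) (p := 2)
    (μ := (volume : Measure R3)) ENNReal.ofNat_ne_top φ) ?_
  rintro ψ ⟨g, hg, hc, hs⟩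
  refine ⟨fun l' => if l' = l then g else 0, fun l' => ?_, ?_⟩
  · dsimp only
    split_ifs
    · exact ⟨hs, hc⟩
    · exact ⟨contDiff_const, HasCompactSupport.zero⟩
  · refine ae_photon_of_slices fun l' => ?_
    have h1 := component_ae l' (inject l ψ)
    rw [component_inject] at h1
    dsimp only
    split_ifs with hl
    · rw [if_pos hl] at h1
      filter_upwards [h1, hg] with k h1 h2
      rw [← h1, h2]
    · rw [if_neg hl] at h1
      filter_upwards [h1, Lp.coeFn_zero ℂ 2 (volume : Measure R3)] with k h1 h2
      rw [← h1, h2]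

theorem dense_testFunctions : testFunctions.topologicalClosure = ⊤ := by
  refine eq_top_iff.2 fun f _ => ?_
  rw [← sum_inject_component f]
  exact Submodule.sum_mem _ fun l _ => inject_mem_closure_testFunctions l _

theorem mem_absK_domain_of_mem_testFunctions {f : OnePhoton} (hf : f ∈ testFunctions) :
    f ∈ absK.domain := by
  obtain ⟨φ, hφ, hf⟩ := hf
  have hb : ∀ l, ∃ C : ℝ, ∀ k, φ l k ≠ 0 → ‖k‖ ≤ C := fun l => by
    obtain ⟨C, hC⟩ := (hφ l).2.isBounded.exists_norm_le
    exact ⟨C, fun k hk => hC k (subset_tsupport _ hk)⟩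
  choose C hC using hb
  have hm : Measurable fun p : R3 × Fin 2 => ((‖p.1‖ : ℝ) : ℂ) := by fun_prop
  refine (Lp.memLp f).of_le_mul (c := ∑ l, |C l|)
    (hm.aestronglyMeasurable.mul (Lp.aestronglyMeasurable f)) ?_
  filter_upwards [hf] with p hp
  rw [norm_mul, Complex.norm_real, Real.norm_of_nonneg (norm_nonneg _)]
  by_cases h0 : φ p.2 p.1 = 0
  · rw [hp, h0]; simp
  · refine mul_le_mul_of_nonneg_right ?_ (norm_nonneg _)
    exact ((hC p.2 p.1 h0).trans (le_abs_self _)).trans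
      (Finset.single_le_sum (f := fun l => |C l|) (fun _ _ => abs_nonneg _) (Finset.mem_univ _))

theorem testFunctions_le_absK_domain : testFunctions ≤ absK.domain :=
  fun _ => mem_absK_domain_of_mem_testFunctions

/-- With `F = √(1 + |k|²) f`, the pair `(f, g)` is the image of `F` under the bounded map `L = ((1 +
|k|²)^(-1/2), |k| (1 + |k|²)^(-1/2))`, and `F` is a limit of test functions. The weight is smooth,
unlike `1 + |k|`, so the first component of `L` preserves test functions. -/
theorem mem_closure_absK_testFunctions {f g : OnePhoton} (hfg : (f, g) ∈ absK.graph) :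
    (f, g) ∈ closure {p : OnePhoton × OnePhoton | p ∈ absK.graph ∧ p.1 ∈ testFunctions} := by
  have hq : ∀ p : R3 × Fin 2, 0 < 1 + ‖p.1‖ ^ 2 := fun p => by positivity
  have hm1 : Measurable fun p : R3 × Fin 2 => (((Real.sqrt (1 + ‖p.1‖ ^ 2))⁻¹ : ℝ) : ℂ) := by
    fun_prop
  have hb1 : ∀ p : R3 × Fin 2, ‖(((Real.sqrt (1 + ‖p.1‖ ^ 2))⁻¹ : ℝ) : ℂ)‖ ≤ 1 := fun p => by
    rw [Complex.norm_real, Real.norm_of_nonneg (by positivity)]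
    exact inv_le_one_of_one_le₀ (Real.one_le_sqrt.2 (by nlinarith [norm_nonneg p.1]))
  have hm2 : Measurable fun p : R3 × Fin 2 =>
      ((‖p.1‖ * (Real.sqrt (1 + ‖p.1‖ ^ 2))⁻¹ : ℝ) : ℂ) := by fun_prop
  have hb2 : ∀ p : R3 × Fin 2, ‖((‖p.1‖ * (Real.sqrt (1 + ‖p.1‖ ^ 2))⁻¹ : ℝ) : ℂ)‖ ≤ 1 :=
    fun p => by
      rw [Complex.norm_real, Real.norm_of_nonneg (by positivity), ← div_eq_mul_inv,
        div_le_one (Real.sqrt_pos.2 (hq p))]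
      exact Real.le_sqrt_of_sq_le (by linarith)
  have hg := (isDiagonalizedBy_absK f g).1 hfg
  have hF : MemLp (fun p => ((Real.sqrt (1 + ‖p.1‖ ^ 2) : ℝ) : ℂ) * f p) 2 photonMeasure := by
    have hm : Measurable fun p : R3 × Fin 2 => ((Real.sqrt (1 + ‖p.1‖ ^ 2) : ℝ) : ℂ) := by
      fun_prop
    refine ((Lp.memLp g).add (Lp.memLp f)).mono
      (hm.aestronglyMeasurable.mul (Lp.aestronglyMeasurable f)) ?_
    filter_upwards [hg] with p hp
    simp only [LinearIsometryEquiv.coe_refl, id_eq] at hp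
    have h2 : ((‖p.1‖ : ℝ) : ℂ) * f p + f p = ((‖p.1‖ + 1 : ℝ) : ℂ) * f p := by push_cast; ring
    rw [Pi.add_apply, hp, h2, norm_mul, norm_mul]
    refine mul_le_mul_of_nonneg_right ?_ (norm_nonneg _)
    rw [Complex.norm_real, Complex.norm_real, Real.norm_of_nonneg (Real.sqrt_nonneg _),
      Real.norm_of_nonneg (by positivity)]
    exact Real.sqrt_le_iff.2 ⟨by positivity, by nlinarith [norm_nonneg p.1]⟩
  set F := hF.toLp _
  have hFae : F =ᵐ[photonMeasure] fun p => ((Real.sqrt (1 + ‖p.1‖ ^ 2) : ℝ) : ℂ) * f p :=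
    hF.coeFn_toLp
  let L : OnePhoton →L[ℂ] OnePhoton × OnePhoton :=
    (boundedMul photonMeasure hm1 hb1).prod (boundedMul photonMeasure hm2 hb2)
  have hL : L F = (f, g) := by
    refine Prod.ext (Lp.ext ?_) (Lp.ext ?_)
    · filter_upwards [boundedMul_ae hm1 hb1 F, hFae] with p h1 h2
      refine h1.trans ?_
      rw [h2, ← mul_assoc, ← Complex.ofReal_mul, inv_mul_cancel₀ (Real.sqrt_pos.2 (hq p)).ne',
        Complex.ofReal_one, one_mul]
    · filter_upwards [boundedMul_ae hm2 hb2 F, hFae, hg] with p h1 h2 h3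
      refine h1.trans ?_
      simp only [LinearIsometryEquiv.coe_refl, id_eq] at h3
      rw [h2, h3, ← mul_assoc, ← Complex.ofReal_mul, mul_assoc,
        inv_mul_cancel₀ (Real.sqrt_pos.2 (hq p)).ne', mul_one]
  rw [← hL]
  refine map_mem_closure L.continuous
    (show F ∈ closure (testFunctions : Set OnePhoton) by
      rw [← Submodule.topologicalClosure_coe, dense_testFunctions]; trivial) ?_
  intro s hs
  refine ⟨(isDiagonalizedBy_absK _ _).2 ?_, ?_⟩
  · filter_upwards [boundedMul_ae hm1 hb1 s, boundedMul_ae hm2 hb2 s] with p h1 h2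
    refine h2.trans ?_
    simp only [LinearIsometryEquiv.coe_refl, id_eq]
    refine Eq.trans ?_ (congrArg _ h1.symm)
    rw [← mul_assoc, ← Complex.ofReal_mul]
  · obtain ⟨φ, hφ, hs⟩ := hs
    refine ⟨fun l k => (((Real.sqrt (1 + ‖k‖ ^ 2))⁻¹ : ℝ) : ℂ) * φ l k, fun l => ⟨?_, ?_⟩, ?_⟩
    · refine ContDiff.mul ?_ (hφ l).1
      refine Complex.ofRealCLM.contDiff.comp ?_
      refine ContDiff.inv (ContDiff.sqrt (contDiff_const.add (contDiff_norm_sq ℝ)) ?_) ?_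
      · intro k; positivity
      · intro k; positivity
    · exact (hφ l).2.mul_left
    · filter_upwards [boundedMul_ae hm1 hb1 s, hs] with p h1 h2
      refine h1.trans ?_
      rw [h2]

end Photon

/-! ### Hardy's inequality on `ℝ³`, regularized -/

section Hardy

open SchwartzMap LineDeriv

variable {ε : ℝ}

theorem hasFDerivAt_coord_div (hε : 0 < ε) (j : Fin 3) (x : R3) :
    ∃ L : R3 →L[ℝ] ℝ, HasFDerivAt (fun y : R3 => y j / (‖y‖ ^ 2 + ε)) L x ∧
      L (EuclideanSpace.single j 1) =
        (‖x‖ ^ 2 + ε)⁻¹ - 2 * x j ^ 2 * ((‖x‖ ^ 2 + ε)⁻¹) ^ 2 := by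
  have hq : ‖x‖ ^ 2 + ε ≠ 0 := by positivity
  have h1 : HasFDerivAt (fun y : R3 => y j) (EuclideanSpace.proj j : R3 →L[ℝ] ℝ) x :=
    (EuclideanSpace.proj j : R3 →L[ℝ] ℝ).hasFDerivAt
  have h2 : HasFDerivAt (fun y : R3 => ‖y‖ ^ 2 + ε) (2 • innerSL ℝ x) x :=
    (hasStrictFDerivAt_norm_sq x).hasFDerivAt.add_const ε
  simp_rw [div_eq_mul_inv]
  refine ⟨_, h1.mul ((hasDerivAt_inv hq).comp_hasFDerivAt x h2), ?_⟩
  have h3 : inner ℝ x (EuclideanSpace.single j (1 : ℝ)) = x j := by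
    simp [EuclideanSpace.inner_single_right]
  simp [h3]
  field_simp
  ring

theorem integrable_norm_sq (G : 𝓢(R3, ℂ)) : Integrable fun x => ‖G x‖ ^ 2 :=
  (memLp_two_iff_integrable_sq_norm G.continuous.aestronglyMeasurable).1 (G.memLp 2)

/-- Integrate `‖G‖²` by parts against the derivative of `h = xⱼ / (|x|² + ε)` and absorb the result
by Young's inequality. The `5/2` collects `2` from differentiating `h` and `1/2` from Young. -/
theorem hardy_direction (hε : 0 < ε) (G : 𝓢(R3, ℂ)) (j : Fin 3) :
    ∫ x, ‖G x‖ ^ 2 * ((‖x‖ ^ 2 + ε)⁻¹ - 5 / 2 * x j ^ 2 * ((‖x‖ ^ 2 + ε)⁻¹) ^ 2) ≤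
      2 * ∫ x, ‖(∂_{(EuclideanSpace.single j (1 : ℝ) : R3)} G) x‖ ^ 2 := by
  set e : R3 := EuclideanSpace.single j (1 : ℝ)
  have hq : ∀ x : R3, 0 < ‖x‖ ^ 2 + ε := fun x => by positivity
  have hxj : ∀ x : R3, x j ^ 2 ≤ ‖x‖ ^ 2 := fun x => by
    have := EuclideanSpace.norm_sq_eq x
    rw [this]
    simpa using Finset.single_le_sum (f := fun i => ‖x i‖ ^ 2) (fun _ _ => sq_nonneg _)
      (Finset.mem_univ j)
  have hinv : ∀ x : R3, (‖x‖ ^ 2 + ε)⁻¹ ≤ ε⁻¹ := fun x =>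
    inv_anti₀ hε (by linarith [sq_nonneg ‖x‖])
  have hxq : ∀ x : R3, x j ^ 2 * ((‖x‖ ^ 2 + ε)⁻¹) ^ 2 ≤ ε⁻¹ := fun x => by
    refine le_trans ?_ (hinv x)
    rw [sq (‖x‖ ^ 2 + ε)⁻¹, ← mul_assoc]
    refine mul_le_of_le_one_left (inv_pos.2 (hq x)).le ?_
    rw [← div_eq_mul_inv, div_le_one (hq x)]
    linarith [hxj x]
  let h : R3 → ℝ := fun y => y j / (‖y‖ ^ 2 + ε)
  have hhd : ∀ x, DifferentiableAt ℝ h x := fun x => by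
    obtain ⟨L, hL, -⟩ := hasFDerivAt_coord_div hε j x
    exact hL.differentiableAt
  have hh' : ∀ x, fderiv ℝ h x e =
      (‖x‖ ^ 2 + ε)⁻¹ - 2 * x j ^ 2 * ((‖x‖ ^ 2 + ε)⁻¹) ^ 2 := fun x => by
    obtain ⟨L, hL, hLe⟩ := hasFDerivAt_coord_div hε j x
    rw [hL.fderiv, hLe]
  have hhb : ∀ x, ‖h x‖ ^ 2 = x j ^ 2 * ((‖x‖ ^ 2 + ε)⁻¹) ^ 2 := fun x => by
    rw [Real.norm_eq_abs, sq_abs, div_pow, div_eq_mul_inv, inv_pow]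
  have hhc : Continuous h := continuous_iff_continuousAt.2 fun x => (hhd x).continuousAt
  have hGd : ∀ x, HasFDerivAt (fun y => ‖G y‖ ^ 2) (2 • (innerSL ℝ (G x)).comp (fderiv ℝ G x)) x :=
    fun x => (G.differentiableAt (x := x)).hasFDerivAt.norm_sq
  have hG' : ∀ x, fderiv ℝ (fun y => ‖G y‖ ^ 2) x e = 2 * inner ℝ (G x) ((∂_{e} G) x) := fun x => by
    rw [(hGd x).fderiv]
    simp [lineDerivOp_apply_eq_fderiv]
    ring
  have hGi := integrable_norm_sq G
  have hDi := integrable_norm_sq (∂_{e} G)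
  have hbdd : ∀ {k : R3 → ℝ} {C : ℝ}, Continuous k → (∀ x, ‖k x‖ ≤ C) →
      Integrable fun x => ‖G x‖ ^ 2 * k x := fun {k C} hk hC =>
    hGi.mul_bdd (c := C) hk.aestronglyMeasurable (Filter.Eventually.of_forall hC)
  have hci : Continuous fun x : R3 => (‖x‖ ^ 2 + ε)⁻¹ :=
    Continuous.inv₀ (by fun_prop) fun x => (hq x).ne'
  have hcj : Continuous fun x : R3 => x j := by fun_prop
  have i1 : Integrable fun x => ‖G x‖ ^ 2 * (‖x‖ ^ 2 + ε)⁻¹ :=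
    hbdd hci (C := ε⁻¹) fun x => by
      rw [Real.norm_of_nonneg (inv_pos.2 (hq x)).le]; exact hinv x
  have i2 : Integrable fun x : R3 => ‖G x‖ ^ 2 * (x j ^ 2 * ((‖x‖ ^ 2 + ε)⁻¹) ^ 2) :=
    hbdd ((hcj.pow 2).mul (hci.pow 2)) (C := ε⁻¹) fun x => by
      rw [Real.norm_of_nonneg (by positivity)]; exact hxq x
  have i3 : Integrable fun x => ‖G x‖ ^ 2 * fderiv ℝ h x e := by
    refine (i1.sub (i2.const_mul 2)).congr (Filter.Eventually.of_forall fun x => ?_)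
    simp only [Pi.sub_apply, hh']
    ring
  have hpt : ∀ x, |fderiv ℝ (fun y => ‖G y‖ ^ 2) x e * h x| ≤
      2 * ‖(∂_{e} G) x‖ ^ 2 + 1 / 2 * (‖G x‖ ^ 2 * (x j ^ 2 * ((‖x‖ ^ 2 + ε)⁻¹) ^ 2)) := fun x => by
    rw [hG', ← hhb, abs_mul, abs_mul, abs_two, ← Real.norm_eq_abs (h x)]
    have h1 := abs_real_inner_le_norm (G x) ((∂_{e} G) x)
    have h2 := mul_le_mul_of_nonneg_right h1 (norm_nonneg (h x))
    -- Young's inequality `2st ≤ 2s² + t²/2`, with the weights that give the sharp Hardy constant.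
    nlinarith [sq_nonneg (2 * ‖(∂_{e} G) x‖ - ‖G x‖ * ‖h x‖)]
  have i5 : Integrable fun x => 2 * ‖(∂_{e} G) x‖ ^ 2 +
      1 / 2 * (‖G x‖ ^ 2 * (x j ^ 2 * ((‖x‖ ^ 2 + ε)⁻¹) ^ 2)) :=
    (hDi.const_mul 2).add (i2.const_mul (1 / 2))
  have i4 : Integrable fun x => fderiv ℝ (fun y => ‖G y‖ ^ 2) x e * h x := by
    refine i5.mono' ?_ (Filter.Eventually.of_forall hpt)
    refine Continuous.aestronglyMeasurable ?_
    simp_rw [hG']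
    exact (continuous_const.mul (G.continuous.inner (∂_{e} G).continuous)).mul hhc
  have i6 : Integrable fun x => ‖G x‖ ^ 2 * h x :=
    hbdd hhc (C := 1 + ε⁻¹) fun x => by
      have h1 := hhb x ▸ hxq x
      have h2 : 0 < ε⁻¹ := inv_pos.2 hε
      -- From `‖h‖² ≤ ε⁻¹`; the crude bound `1 + ε⁻¹` avoids a square root.
      nlinarith [norm_nonneg (h x)]
  have hibp := integral_mul_fderiv_eq_neg_fderiv_mul_of_integrable (μ := (volume : Measure R3))
    i4 i3 i6 (fun x _ => (hGd x).differentiableAt) (fun x _ => hhd x)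
  have hle : ∫ x, ‖G x‖ ^ 2 * fderiv ℝ h x e ≤ ∫ x, (2 * ‖(∂_{e} G) x‖ ^ 2 +
      1 / 2 * (‖G x‖ ^ 2 * (x j ^ 2 * ((‖x‖ ^ 2 + ε)⁻¹) ^ 2))) := by
    rw [hibp, ← integral_neg]
    exact integral_mono i4.neg i5 fun x => (neg_le_abs _).trans (hpt x)
  rw [integral_add (hDi.const_mul 2) (i2.const_mul (1 / 2)), integral_const_mul] at hle
  have heq : ∫ x, ‖G x‖ ^ 2 * ((‖x‖ ^ 2 + ε)⁻¹ - 5 / 2 * x j ^ 2 * ((‖x‖ ^ 2 + ε)⁻¹) ^ 2) =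
      (∫ x, ‖G x‖ ^ 2 * fderiv ℝ h x e) -
        ∫ x, 1 / 2 * (‖G x‖ ^ 2 * (x j ^ 2 * ((‖x‖ ^ 2 + ε)⁻¹) ^ 2)) := by
    rw [← integral_sub i3 (i2.const_mul (1 / 2))]
    refine integral_congr_ae (Filter.Eventually.of_forall fun x => ?_)
    simp only [hh']
    ring
  rw [heq]
  linarith

/-- Summing over the three directions, with `q = |x|² + ε`, the weight is `3/q - (5/2)|x|²/q²`.
Since `|x|² ≤ q` it is at least `1/(2q)`, and `½ ∫ ‖G‖²/q ≤ 2 ∫ ‖∇G‖²` gives the constant `4`. -/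
theorem hardy_schwartz (hε : 0 < ε) (G : 𝓢(R3, ℂ)) :
    ∫ x, ‖G x‖ ^ 2 * (‖x‖ ^ 2 + ε)⁻¹ ≤
      4 * ∑ j : Fin 3, ∫ x, ‖(∂_{(EuclideanSpace.single j (1 : ℝ) : R3)} G) x‖ ^ 2 := by
  have hq : ∀ x : R3, 0 < ‖x‖ ^ 2 + ε := fun x => by positivity
  have hinv : ∀ x : R3, (‖x‖ ^ 2 + ε)⁻¹ ≤ ε⁻¹ := fun x =>
    inv_anti₀ hε (by linarith [sq_nonneg ‖x‖])
  have hsum : ∀ x : R3, ∑ j, x j ^ 2 = ‖x‖ ^ 2 := fun x => by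
    rw [EuclideanSpace.norm_sq_eq x]
    simp
  have hci : Continuous fun x : R3 => (‖x‖ ^ 2 + ε)⁻¹ :=
    Continuous.inv₀ (by fun_prop) fun x => (hq x).ne'
  have i1 : Integrable fun x => ‖G x‖ ^ 2 * (‖x‖ ^ 2 + ε)⁻¹ :=
    (integrable_norm_sq G).mul_bdd (c := ε⁻¹) hci.aestronglyMeasurable
      (Filter.Eventually.of_forall fun x => by
        rw [Real.norm_of_nonneg (inv_pos.2 (hq x)).le]; exact hinv x)
  have ij : ∀ j : Fin 3, Integrable fun x : R3 =>
      ‖G x‖ ^ 2 * ((‖x‖ ^ 2 + ε)⁻¹ - 5 / 2 * x j ^ 2 * ((‖x‖ ^ 2 + ε)⁻¹) ^ 2) := fun j => by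
    have hcj : Continuous fun x : R3 => x j := by fun_prop
    refine (integrable_norm_sq G).mul_bdd (c := ε⁻¹ * 4)
      ((hci.sub (((continuous_const.mul (hcj.pow 2)).mul (hci.pow 2)))).aestronglyMeasurable)
      (Filter.Eventually.of_forall fun x => ?_)
    have h1 : x j ^ 2 ≤ ‖x‖ ^ 2 := by
      rw [← hsum]
      exact Finset.single_le_sum (f := fun i => x i ^ 2) (fun _ _ => sq_nonneg _)
        (Finset.mem_univ j)
    have h2 : x j ^ 2 * (‖x‖ ^ 2 + ε)⁻¹ ≤ 1 := by
      rw [← div_eq_mul_inv, div_le_one (hq x)]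
      linarith
    have h3 := hinv x
    have h4 : 0 < (‖x‖ ^ 2 + ε)⁻¹ := inv_pos.2 (hq x)
    have h5 : 0 ≤ x j ^ 2 * (‖x‖ ^ 2 + ε)⁻¹ := by positivity
    rw [Real.norm_eq_abs, abs_le]
    constructor <;> nlinarith
  have hs : ∫ x, ∑ j : Fin 3, ‖G x‖ ^ 2 *
      ((‖x‖ ^ 2 + ε)⁻¹ - 5 / 2 * x j ^ 2 * ((‖x‖ ^ 2 + ε)⁻¹) ^ 2) ≤
      2 * ∑ j : Fin 3, ∫ x, ‖(∂_{(EuclideanSpace.single j (1 : ℝ) : R3)} G) x‖ ^ 2 := by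
    rw [integral_finsetSum _ fun j _ => ij j, Finset.mul_sum]
    exact Finset.sum_le_sum fun j _ => hardy_direction hε G j
  have hle : ∫ x, 1 / 2 * (‖G x‖ ^ 2 * (‖x‖ ^ 2 + ε)⁻¹) ≤ ∫ x, ∑ j : Fin 3, ‖G x‖ ^ 2 *
      ((‖x‖ ^ 2 + ε)⁻¹ - 5 / 2 * x j ^ 2 * ((‖x‖ ^ 2 + ε)⁻¹) ^ 2) := by
    refine integral_mono (i1.const_mul _) (integrable_finsetSum _ fun j _ => ij j) fun x => ?_
    have h4 : 0 < (‖x‖ ^ 2 + ε)⁻¹ := inv_pos.2 (hq x)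
    have h5 : ‖x‖ ^ 2 * (‖x‖ ^ 2 + ε)⁻¹ ≤ 1 := by
      rw [← div_eq_mul_inv, div_le_one (hq x)]
      linarith
    have h6 : ∑ j : Fin 3, ‖G x‖ ^ 2 * ((‖x‖ ^ 2 + ε)⁻¹ - 5 / 2 * x j ^ 2 *
        ((‖x‖ ^ 2 + ε)⁻¹) ^ 2) = ‖G x‖ ^ 2 * (3 * (‖x‖ ^ 2 + ε)⁻¹ -
        5 / 2 * ‖x‖ ^ 2 * ((‖x‖ ^ 2 + ε)⁻¹) ^ 2) := by
      rw [← hsum, Fin.sum_univ_three, Fin.sum_univ_three]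
      ring
    dsimp only
    rw [h6, mul_left_comm]
    refine mul_le_mul_of_nonneg_left ?_ (sq_nonneg _)
    nlinarith
  rw [integral_const_mul] at hle
  linarith

/-- A derivative of `𝓕 S` is the Fourier transform of `-2πi xⱼ S`; then Plancherel. -/
theorem sum_integral_lineDeriv_fourier (S : 𝓢(R3, ℂ)) :
    ∑ j : Fin 3, ∫ x, ‖(∂_{(EuclideanSpace.single j (1 : ℝ) : R3)} (𝓕 S)) x‖ ^ 2 =
      4 * Real.pi ^ 2 * ∫ x, (‖x‖ * ‖S x‖) ^ 2 := by
  have hj : ∀ j : Fin 3, ∃ T : 𝓢(R3, ℂ), (∀ x, ‖T x‖ ^ 2 = 4 * Real.pi ^ 2 * (x j ^ 2 * ‖S x‖ ^ 2)) ∧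
      ∂_{(EuclideanSpace.single j (1 : ℝ) : R3)} (𝓕 S) = 𝓕 T := fun j => by
    refine ⟨_, fun x => ?_, lineDerivOp_fourier_eq S _⟩
    have ht : (fun x : R3 => inner ℝ x (EuclideanSpace.single j (1 : ℝ) : R3)).HasTemperateGrowth := by
      fun_prop
    have h3 : inner ℝ x (EuclideanSpace.single j (1 : ℝ)) = x j := by
      simp [EuclideanSpace.inner_single_right]
    simp [smulLeftCLM_apply_apply ht, h3, mul_pow]
    left
    ring
  choose T hT hT' using hj
  have h1 : ∀ j : Fin 3, ∫ x, ‖(∂_{(EuclideanSpace.single j (1 : ℝ) : R3)} (𝓕 S)) x‖ ^ 2 =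
      ∫ x, ‖T j x‖ ^ 2 := fun j => by
    rw [hT' j]
    exact integral_norm_sq_fourier (T j)
  simp_rw [h1]
  rw [← integral_finsetSum _ fun j _ => integrable_norm_sq (T j), ← integral_const_mul]
  refine integral_congr_ae (Filter.Eventually.of_forall fun x => ?_)
  simp only [hT]
  rw [← Finset.mul_sum, ← Finset.sum_mul, mul_pow, EuclideanSpace.norm_sq_eq x]
  simp

end Hardy

/-! ### The one-particle estimate for `|k|` and the regularized `|i∇|⁻¹` -/

section OneParticle

variable {ε : ℝ}

/-- The regularization `(2π √(|ξ|² + ε))⁻¹` of the symbol of `|i∇|⁻¹`. -/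
def hardyMultiplier (ε : ℝ) (p : R3 × Fin 2) : ℝ :=
  (2 * Real.pi * Real.sqrt (‖p.1‖ ^ 2 + ε))⁻¹

theorem hardyMultiplier_pos (hε : 0 < ε) (p : R3 × Fin 2) : 0 < hardyMultiplier ε p := by
  have : 0 < Real.sqrt (‖p.1‖ ^ 2 + ε) := Real.sqrt_pos.2 (by positivity)
  unfold hardyMultiplier
  positivity

theorem measurable_hardyMultiplier (ε : ℝ) : Measurable fun p => (hardyMultiplier ε p : ℂ) := by
  unfold hardyMultiplier
  fun_prop

theorem norm_hardyMultiplier_le (hε : 0 < ε) (p : R3 × Fin 2) :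
    ‖(hardyMultiplier ε p : ℂ)‖ ≤ (2 * Real.pi * Real.sqrt ε)⁻¹ := by
  rw [Complex.norm_real, Real.norm_of_nonneg (hardyMultiplier_pos hε p).le]
  have : 0 < Real.sqrt ε := Real.sqrt_pos.2 hε
  refine inv_anti₀ (by positivity) ?_
  gcongr
  linarith [sq_nonneg ‖p.1‖]

/-- Here `√(s² + t²) ≤ s + t` with `t = r / (2π)`, the value of `√ε` for which `2π t = r`. -/
theorem inv_hardyMultiplier_le {r : ℝ} (hr : 0 < r) (p : R3 × Fin 2) :
    (hardyMultiplier ((r / (2 * Real.pi)) ^ 2) p)⁻¹ ≤ 2 * Real.pi * ‖p.1‖ + r := by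
  have hs : Real.sqrt (‖p.1‖ ^ 2 + (r / (2 * Real.pi)) ^ 2) ≤ ‖p.1‖ + r / (2 * Real.pi) := by
    have : 0 < r / (2 * Real.pi) := by positivity
    refine Real.sqrt_le_iff.2 ⟨by positivity, ?_⟩
    nlinarith [norm_nonneg p.1]
  rw [hardyMultiplier, inv_inv]
  refine (mul_le_mul_of_nonneg_left hs (by positivity)).trans_eq ?_
  field_simp

theorem norm_sq_eq_integral {α : Type*} [MeasurableSpace α] {μ : Measure α} (g : Lp ℂ 2 μ) :
    ‖g‖ ^ 2 = ∫ x, ‖g x‖ ^ 2 ∂μ := by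
  rw [← inner_self_eq_norm_sq (𝕜 := ℂ), L2.inner_def, ← integral_re (L2.integrable_inner g g)]
  simp_rw [inner_self_eq_norm_sq]

/-- Hardy's inequality for the Fourier transform of each component: the `4π²` from Plancherel
cancels the `(2π)⁻²` in the squared multiplier. -/
theorem norm_hardyMultiplier_mul_le_of_testFunctions (hε : 0 < ε) {f g : OnePhoton}
    (hf : f ∈ testFunctions) (hfg : (f, g) ∈ absK.graph) :
    ‖boundedMul photonMeasure (measurable_hardyMultiplier ε) (norm_hardyMultiplier_le hε)
      (fourierPhoton f)‖ ≤ 2 * ‖g‖ := by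
  obtain ⟨φ, hφ, hfφ⟩ := hf
  have hg := ae_component_iff.1 ((isDiagonalizedBy_absK f g).1 hfg)
  simp only [LinearIsometryEquiv.coe_refl, id_eq] at hg
  have hm := ae_component_iff.1 (boundedMul_ae (measurable_hardyMultiplier ε)
    (norm_hardyMultiplier_le hε) (fourierPhoton f))
  suffices h : ∀ l, ‖component l (boundedMul photonMeasure (measurable_hardyMultiplier ε)
      (norm_hardyMultiplier_le hε) (fourierPhoton f))‖ ^ 2 ≤ 4 * ‖component l g‖ ^ 2 by
    rw [← sq_le_sq₀ (norm_nonneg _) (by positivity), mul_pow, norm_sq_eq_sum_component,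
      norm_sq_eq_sum_component g, Finset.mul_sum]
    refine Finset.sum_le_sum fun l _ => ?_
    norm_num
    exact h l
  intro l
  let S : SchwartzMap R3 ℂ := (hφ l).2.toSchwartzMap (hφ l).1
  have hS : component l f = S.toLp 2 := by
    refine Lp.ext ?_
    filter_upwards [component_ae l f, ae_slice hfφ l, S.coeFn_toLp 2 volume] with k h1 h2 h3
    rw [h1, h2, h3]
    rfl
  have h1 : ‖component l (boundedMul photonMeasure (measurable_hardyMultiplier ε)
      (norm_hardyMultiplier_le hε) (fourierPhoton f))‖ ^ 2 =
      ((2 * Real.pi) ^ 2)⁻¹ * ∫ x, ‖(𝓕 S) x‖ ^ 2 * (‖x‖ ^ 2 + ε)⁻¹ := by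
    rw [norm_sq_eq_integral, ← integral_const_mul]
    refine integral_congr_ae ?_
    have h2 := (𝓕 S).coeFn_toLp 2 (volume : Measure R3)
    rw [← SchwartzMap.toLp_fourier_eq, ← hS, ← component_fourierPhoton] at h2
    filter_upwards [hm l, h2] with k h3 h4
    rw [h3, h4, norm_mul, Complex.norm_real, Real.norm_of_nonneg (hardyMultiplier_pos hε _).le,
      hardyMultiplier, mul_pow, inv_pow, mul_pow (2 * Real.pi), Real.sq_sqrt (by positivity),
      mul_inv]
    ring
  have h2 : ‖component l g‖ ^ 2 = ∫ x, (‖x‖ * ‖S x‖) ^ 2 := by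
    rw [norm_sq_eq_integral]
    refine integral_congr_ae ?_
    have h2 := S.coeFn_toLp 2 (volume : Measure R3)
    rw [← hS] at h2
    filter_upwards [hg l, h2] with k h3 h4
    rw [h3, h4, norm_mul, Complex.norm_real, norm_norm]
  have h3 := hardy_schwartz hε (𝓕 S)
  rw [sum_integral_lineDeriv_fourier] at h3
  rw [h1, h2, inv_mul_le_iff₀ (by positivity)]
  refine h3.trans_eq ?_
  ring

theorem norm_le_of_mem_closure {E F G : Type*} [SeminormedAddCommGroup E]
    [SeminormedAddCommGroup F] [SeminormedAddCommGroup G] {M : E → F} (hM : Continuous M) {c : ℝ}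
    {D : Set (E × G)} (h : ∀ p ∈ D, ‖M p.1‖ ≤ c * ‖p.2‖) {p : E × G} (hp : p ∈ closure D) :
    ‖M p.1‖ ≤ c * ‖p.2‖ :=
  closure_minimal h (isClosed_le (hM.comp continuous_fst).norm
    (continuous_const.mul continuous_snd.norm)) hp

theorem norm_hardyMultiplier_mul_le (hε : 0 < ε) {f g : OnePhoton} (hfg : (f, g) ∈ absK.graph) :
    ‖boundedMul photonMeasure (measurable_hardyMultiplier ε) (norm_hardyMultiplier_le hε)
      (fourierPhoton f)‖ ≤ 2 * ‖g‖ := by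
  have hM : Continuous fun f => boundedMul photonMeasure (measurable_hardyMultiplier ε)
      (norm_hardyMultiplier_le hε) (fourierPhoton f) :=
    (ContinuousLinearMap.continuous _).comp fourierPhoton.continuous
  refine norm_le_of_mem_closure (p := (f, g)) hM ?_ (mem_closure_absK_testFunctions hfg)
  rintro ⟨f, g⟩ hp
  exact norm_hardyMultiplier_mul_le_of_testFunctions hε hp.2 hp.1

theorem inner_absK (f g : absK.domain) :
    inner ℂ (f : OnePhoton) (absK g) = inner ℂ (absK f) (g : OnePhoton) := by
  rw [L2.inner_def, L2.inner_def]
  refine integral_congr_ae ?_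
  filter_upwards [absK_ae f, absK_ae g] with x h1 h2
  rw [h1, h2]
  simp
  ring

end OneParticle

/-! ### Products of test functions as a core for the second quantization -/

section Core

variable {X : Type*} [MeasurableSpace X] {μ : Measure X} [SigmaFinite μ]

/-- The restriction of `dGammaAlgGraph A` to product vectors with factors in `V`. -/
def dGammaCore (A : Lp ℂ 2 μ →ₗ.[ℂ] Lp ℂ 2 μ) (V : Submodule ℂ (Lp ℂ 2 μ)) :
    Submodule ℂ (Fock μ × Fock μ) :=
  Submodule.span ℂ {p | ∃ (n : ℕ) (f : Fin n → A.domain), (∀ i, (f i : Lp ℂ 2 μ) ∈ V) ∧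
    p.1 = lp.single 2 n (symTensor fun i => (f i : Lp ℂ 2 μ)) ∧
    p.2 = lp.single 2 n (∑ j : Fin n,
      symTensor (Function.update (fun i => (f i : Lp ℂ 2 μ)) j (A (f j))))}

theorem dGammaCore_le (A : Lp ℂ 2 μ →ₗ.[ℂ] Lp ℂ 2 μ) (V : Submodule ℂ (Lp ℂ 2 μ)) :
    dGammaCore A V ≤ dGammaAlgGraph A := by
  refine Submodule.span_le.2 ?_
  rintro p ⟨n, f, -, h1, h2⟩
  exact Submodule.subset_span ⟨n, f, h1, h2⟩

theorem fockPair_tensorMap {n : ℕ} (f : Fin n → Lp ℂ 2 μ) (g : Fin n → Fin n → Lp ℂ 2 μ) :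
    fockPair μ n (tensorMap μ n f, ∑ j, tensorMap μ n (g j)) =
      (lp.single 2 n (symTensor f), lp.single 2 n (∑ j, symTensor (g j))) := by
  rw [fockPair_apply, map_sum]
  simp_rw [tensorMap_apply, symProj_tensor]

/-- A generator of the graph depends continuously, through `Θ`, on the `n` one-particle pairs `(f i,
A (f i))`, so approximating each pair from the one-particle core is enough. -/
theorem dGammaAlgGraph_le_closure_core {A : Lp ℂ 2 μ →ₗ.[ℂ] Lp ℂ 2 μ} {V : Submodule ℂ (Lp ℂ 2 μ)}
    (h : ∀ p ∈ A.graph, p ∈ closure {q | q ∈ A.graph ∧ q.1 ∈ V}) :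
    dGammaAlgGraph A ≤ (dGammaCore A V).topologicalClosure := by
  refine Submodule.span_le.2 ?_
  rintro p ⟨n, f, h1, h2⟩
  let Θ : (Fin n → Lp ℂ 2 μ × Lp ℂ 2 μ) → Fock μ × Fock μ := fun q =>
    fockPair μ n (tensorMap μ n fun i => (q i).1,
      ∑ j, tensorMap μ n (Function.update (fun i => (q i).1) j (q j).2))
  have hΘ : Continuous Θ := by
    refine (fockPair μ n).continuous.comp (Continuous.prodMk ?_ ?_)
    · exact (tensorMap μ n).cont.comp (by fun_prop)
    · refine continuous_finsetSum _ fun j _ => (tensorMap μ n).cont.comp ?_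
      exact Continuous.update (by fun_prop) j (by fun_prop)
  have hp : p = Θ fun i => ((f i : Lp ℂ 2 μ), A (f i)) :=
    (Prod.ext h1 h2).trans (fockPair_tensorMap _ _).symm
  rw [SetLike.mem_coe, hp]
  have hcl : (fun i => ((f i : Lp ℂ 2 μ), A (f i))) ∈
      closure (Set.univ.pi fun _ : Fin n => {q | q ∈ A.graph ∧ q.1 ∈ V}) := by
    rw [closure_pi_set]
    exact fun i _ => h _ (A.mem_graph (f i))
  refine map_mem_closure hΘ hcl fun q hq => ?_
  choose g hg1 hg2 using fun i => (LinearPMap.mem_graph_iff A).1 (hq i trivial).1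
  refine Submodule.subset_span ⟨n, g, fun i => ?_, ?_, ?_⟩
  · rw [hg1]; exact (hq i trivial).2
  · simp only [Θ, fockPair_tensorMap, hg1]
  · simp only [Θ, fockPair_tensorMap, hg1, hg2]

theorem eq_sum_single {Φ : Fock μ} {N : ℕ} (h : ∀ n ≥ N, Φ n = 0) :
    Φ = ∑ n ∈ Finset.range N, lp.single 2 n (Φ n) := by
  refine tendsto_nhds_unique (lp.hasSum_single (E := fun n : ℕ => symSector μ n) (p := 2)
    (by simp) Φ) (hasSum_sum_of_ne_finset_zero fun n hn => ?_)
  rw [h n (by simpa using hn), lp.single_zero]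

theorem single_symTensor_mem_gammaFin {V : Submodule ℂ (Lp ℂ 2 μ)} {n : ℕ} {f : Fin n → Lp ℂ 2 μ}
    (hf : ∀ i, f i ∈ V) : (lp.single 2 n (symTensor f) : Fock μ) ∈ gammaFin V := by
  refine ⟨fun m => ?_, n + 1, fun m hm => lp.single_apply_ne _ _ _ (by omega)⟩
  by_cases hmn : m = n
  · subst hmn
    rw [lp.single_apply_self]
    exact Submodule.subset_span ⟨fun i => ⟨f i, hf i⟩, rfl⟩
  · rw [lp.single_apply_ne _ _ _ hmn]
    exact Submodule.zero_mem _

theorem fst_mem_gammaFin_of_mem_core {A : Lp ℂ 2 μ →ₗ.[ℂ] Lp ℂ 2 μ}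
    {V : Submodule ℂ (Lp ℂ 2 μ)} {p : Fock μ × Fock μ} (hp : p ∈ dGammaCore A V) :
    p.1 ∈ gammaFin V := by
  have h : dGammaCore A V ≤ (gammaFin V).comap (LinearMap.fst ℂ (Fock μ) (Fock μ)) := by
    refine Submodule.span_le.2 ?_
    rintro q ⟨n, f, hf, h1, -⟩
    change q.1 ∈ gammaFin V
    rw [h1]
    exact single_symTensor_mem_gammaFin hf
  exact h hp

theorem gammaFin_le_dGamma_domain {A : Lp ℂ 2 μ →ₗ.[ℂ] Lp ℂ 2 μ} {V : Submodule ℂ (Lp ℂ 2 μ)}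
    (hV : V ≤ A.domain) : gammaFin V ≤ (dGamma A).domain := by
  rintro Φ ⟨h1, N, hN⟩
  rw [eq_sum_single hN]
  refine Submodule.sum_mem _ fun n _ => ?_
  have h : algSymPower V n ≤ (dGamma A).domain.comap
      (lp.lsingle (𝕜 := ℂ) (E := fun n : ℕ => symSector μ n) 2 n) := by
    refine Submodule.span_le.2 ?_
    rintro u ⟨f, rfl⟩
    change lp.single 2 n _ ∈ (dGamma A).domain
    rw [dGamma, Submodule.toLinearPMap_domain]
    exact ⟨(lp.single 2 n (symTensor fun i => (f i : Lp ℂ 2 μ)), lp.single 2 n (∑ j : Fin n,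
        symTensor (Function.update (fun i => (f i : Lp ℂ 2 μ)) j (A ⟨f j, hV (f j).2⟩)))),
      Submodule.le_topologicalClosure _ (Submodule.subset_span
        ⟨n, fun i => ⟨f i, hV (f i).2⟩, rfl, rfl⟩), rfl⟩
  exact h (h1 n)

theorem mem_numberOp_domain {Φ : Fock μ} {N : ℕ} (h : ∀ n ≥ N, Φ n = 0) :
    Φ ∈ (numberOp μ).domain := by
  change Memℓp (fun n : ℕ => (n : ℂ) • Φ n) 2
  refine (((lp.memℓp Φ).norm).const_mul (N : ℝ)).mono fun n => ?_
  rw [norm_smul, Complex.norm_natCast]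
  by_cases hn : N ≤ n
  · simp [h n hn]
  · exact mul_le_mul_of_nonneg_right (by exact_mod_cast (not_le.1 hn).le) (norm_nonneg _)

theorem numberOp_apply (Φ : (numberOp μ).domain) (n : ℕ) :
    numberOp μ Φ n = (n : ℂ) • (Φ : Fock μ) n := rfl

end Core

/-! ### Domains and values of operator products -/

section OpComp

variable {E F G : Type*} [AddCommGroup E] [Module ℂ E] [AddCommGroup F] [Module ℂ F]
  [AddCommGroup G] [Module ℂ G]

theorem mem_opComp_domain {B : F →ₗ.[ℂ] G} {A : E →ₗ.[ℂ] F} {x : E} :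
    x ∈ (opComp B A).domain ↔ ∃ y : A.domain, (y : E) = x ∧ A y ∈ B.domain := by
  constructor
  · rintro ⟨⟨y, hy, rfl⟩, -⟩
    exact ⟨y, rfl, hy⟩
  · rintro ⟨y, rfl, hy⟩
    exact ⟨⟨y, hy, rfl⟩, y.2⟩

theorem opComp_apply {B : F →ₗ.[ℂ] G} {A : E →ₗ.[ℂ] F} (x : (opComp B A).domain) (y : A.domain)
    (hy : (y : E) = x) (h : A y ∈ B.domain) : opComp B A x = B ⟨A y, h⟩ := by
  change B ⟨(A.domRestrict _) x, _⟩ = _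
  congr 2
  exact LinearPMap.domRestrict_apply hy.symm

end OpComp

/-! ### The bounded extension and its uniqueness -/

section

variable {ρ : ℝ}

/-- The component of `(dΓ(|i∇_k|) + ρ)⁻¹` on the `n`-photon space. -/
def gradResolvent (hρ : 0 < ρ) (n : ℕ) :
    symSector photonMeasure n →L[ℂ] symSector photonMeasure n :=
  sectorResolvent (w := fun p : R3 × Fin 2 => 2 * Real.pi * ‖p.1‖) fourierPhoton
    (by fun_prop) (fun _ => by positivity) hρ n

theorem dGamma_absK_graph :
    (dGamma absK).graph = (dGammaAlgGraph absK).topologicalClosure :=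
  isDiagonalizedBy_absK.dGamma_graph (by fun_prop)

/-- The regularization depends on `n` and `ρ`, but the Hardy constant `2` does not; this uniformity
allows the sectors to be summed. -/
theorem norm_sq_smul_gradResolvent_le (hρ : 0 < ρ) {Φ Ψ : Fock photonMeasure}
    (h : (Φ, Ψ) ∈ (dGamma absK).graph) (n : ℕ) :
    ‖((n : ℂ) ^ 2) • gradResolvent hρ n (Φ n)‖ ≤ 2 * ‖Ψ n‖ := by
  -- The vacuum is separate: for `n = 0` the share `ρ / n` is zero in Lean and no positive `ε`
  -- results, but `𝒩²` vanishes there.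
  rcases Nat.eq_zero_or_pos n with rfl | hn
  · rw [Nat.cast_zero, zero_pow two_ne_zero, zero_smul, norm_zero]
    positivity
  have hn' : (0 : ℝ) < n := Nat.cast_pos.2 hn
  have hr : 0 < ρ / n := div_pos hρ hn'
  have hε : 0 < (ρ / n / (2 * Real.pi)) ^ 2 := by positivity
  rw [dGamma_absK_graph] at h
  refine norm_sq_smul_sectorResolvent_le inner_absK _ _ hρ (measurable_hardyMultiplier _)
    (norm_hardyMultiplier_le hε) (hardyMultiplier_pos hε) (inv_hardyMultiplier_le hr)
    (fun f => norm_hardyMultiplier_mul_le hε (absK.mem_graph f)) (fun f => ?_)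
    (sectorPair_mem_closure n h)
  refine re_inner_le_of_norm_le (v := fun p => ‖p.1‖) (by fun_prop) (fun _ => norm_nonneg _) _ _
    (fun f g hfg => ?_) (absK_ae f)
  exact norm_hardyMultiplier_mul_le hε ((isDiagonalizedBy_absK f g).2 hfg)

theorem memℓp_hardyMap (hρ : 0 < ρ) (Φ : (dGamma absK).domain) :
    Memℓp (fun n : ℕ => ((n : ℂ) ^ 2) • gradResolvent hρ n ((Φ : Fock photonMeasure) n)) 2 := by
  refine (((lp.memℓp (dGamma absK Φ)).norm).const_mul (2 : ℝ)).mono fun n => ?_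
  exact norm_sq_smul_gradResolvent_le hρ ((dGamma absK).mem_graph Φ) n

/-- The bounded extension of `(dΓ(|i∇_k|) + ρ)⁻¹ 𝒩²` to the domain of `dΓ(|k|)`. -/
def hardyMap (hρ : 0 < ρ) : (dGamma absK).domain →ₗ[ℂ] Fock photonMeasure where
  toFun Φ := ⟨fun n : ℕ => ((n : ℂ) ^ 2) • gradResolvent hρ n ((Φ : Fock photonMeasure) n),
    memℓp_hardyMap hρ Φ⟩
  map_add' Φ Ψ := by
    ext1; funext n
    change ((n : ℂ) ^ 2) • gradResolvent hρ n
      ((Φ : Fock photonMeasure) n + (Ψ : Fock photonMeasure) n) = _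
    rw [map_add, smul_add]; rfl
  map_smul' c Φ := by
    ext1; funext n
    change ((n : ℂ) ^ 2) • gradResolvent hρ n (c • (Φ : Fock photonMeasure) n) = _
    rw [map_smul, smul_comm]; rfl

theorem hardyMap_apply (hρ : 0 < ρ) (Φ : (dGamma absK).domain) (n : ℕ) :
    hardyMap hρ Φ n = ((n : ℂ) ^ 2) • gradResolvent hρ n ((Φ : Fock photonMeasure) n) := rfl

theorem norm_hardyMap_le (hρ : 0 < ρ) (Φ : (dGamma absK).domain) :
    ‖hardyMap hρ Φ‖ ≤ 2 * ‖dGamma absK Φ‖ := by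
  have h2 : ‖(2 : ℂ) • dGamma absK Φ‖ = 2 * ‖dGamma absK Φ‖ := by
    rw [norm_smul]; simp
  rw [← h2]
  refine lp.norm_mono (by norm_num) fun n => ?_
  rw [hardyMap_apply, lp.coeFn_smul, Pi.smul_apply, norm_smul (2 : ℂ), Complex.norm_ofNat]
  exact norm_sq_smul_gradResolvent_le hρ ((dGamma absK).mem_graph Φ) n

theorem gammaFin_le_hardyOp_domain (hρ : 0 < ρ) :
    gammaFin testFunctions ≤ (hardyOp ρ).domain := by
  rintro Φ ⟨-, N, hN⟩
  have h1 : Φ ∈ (numberOp photonMeasure).domain := mem_numberOp_domain hN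
  have h2 : numberOp photonMeasure ⟨Φ, h1⟩ ∈ (numberOp photonMeasure).domain :=
    mem_numberOp_domain (N := N) fun n hn => by
      rw [numberOp_apply]
      change (n : ℂ) • Φ n = 0
      rw [hN n hn, smul_zero]
  have h3 : Φ ∈ (opComp (numberOp photonMeasure) (numberOp photonMeasure)).domain :=
    mem_opComp_domain.2 ⟨⟨Φ, h1⟩, rfl, h2⟩
  refine mem_opComp_domain.2 ⟨⟨Φ, h3⟩, rfl, ?_⟩
  rw [isDiagonalizedBy_absGrad.invShift_domain (by fun_prop) (fun _ => by positivity) hρ]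
  trivial

theorem hardyOp_apply (hρ : 0 < ρ) (Ψ : (hardyOp ρ).domain) (n : ℕ) :
    hardyOp ρ Ψ n = ((n : ℂ) ^ 2) • gradResolvent hρ n ((Ψ : Fock photonMeasure) n) := by
  obtain ⟨y, hy, h1⟩ := mem_opComp_domain.1 Ψ.2
  obtain ⟨z, hz, h2⟩ := mem_opComp_domain.1 y.2
  have h3 : hardyOp ρ Ψ = _ := opComp_apply Ψ y hy h1
  have h4 := opComp_apply y z hz h2
  rw [h3, isDiagonalizedBy_absGrad.invShift_apply (by fun_prop) (fun _ => by positivity) hρ]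
  change gradResolvent hρ n (opComp (numberOp photonMeasure) (numberOp photonMeasure) y n) = _
  rw [h4, numberOp_apply]
  change gradResolvent hρ n ((n : ℂ) • numberOp photonMeasure z n) = _
  rw [numberOp_apply, hz, hy, smul_smul, map_smul, sq]

/-- Approximate `Φ` in graph norm by `y` with `(y, A y) ∈ D`. Since `S y = 0`, the value `S Φ = S (Φ
- y)` is bounded by the graph norm of `Φ - y`, which tends to zero. -/
theorem eq_zero_of_isBoundedOnDomain {E : Type*} [NormedAddCommGroup E] [NormedSpace ℂ E]
    {A : E →ₗ.[ℂ] E} {S : A.domain →ₗ[ℂ] E} (hS : IsBoundedOnDomain A S)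
    {D : Submodule ℂ (E × E)} (hD : D ≤ A.graph) (hcl : A.graph ≤ D.topologicalClosure)
    (h0 : ∀ Φ : A.domain, ((Φ : E), A Φ) ∈ D → S Φ = 0) : S = 0 := by
  obtain ⟨C, hC⟩ := hS
  refine LinearMap.ext fun Φ => ?_
  rw [LinearMap.zero_apply, ← norm_le_zero_iff]
  obtain ⟨s, hs, hlim⟩ := mem_closure_iff_seq_limit.1 (hcl (A.mem_graph Φ))
  have h1 := (continuous_fst.tendsto _).comp hlim
  have h2 := (continuous_snd.tendsto _).comp hlim
  have h3 := (((h1.const_sub (Φ : E)).norm).add ((h2.const_sub (A Φ)).norm)).const_mul C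
  simp only [sub_self, norm_zero, add_zero, mul_zero] at h3
  refine ge_of_tendsto' h3 fun i => ?_
  obtain ⟨y, hy1, hy2⟩ := (LinearPMap.mem_graph_iff A).1 (hD (hs i))
  have h4 := hC (Φ - y)
  have hy : ((y : E), A y) ∈ D := by
    rw [hy1, hy2]
    exact hs i
  rw [map_sub, LinearPMap.map_sub, h0 y hy, sub_zero, Submodule.coe_sub, hy1, hy2] at h4
  exact h4

theorem dGammaCore_le_dGamma_absK_graph :
    dGammaCore absK testFunctions ≤ (dGamma absK).graph := by
  rw [dGamma_absK_graph]
  exact (dGammaCore_le _ _).trans (Submodule.le_topologicalClosure _)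

theorem dGamma_absK_graph_le_closure_core :
    (dGamma absK).graph ≤ (dGammaCore absK testFunctions).topologicalClosure := by
  rw [dGamma_absK_graph]
  exact Submodule.topologicalClosure_minimal _
    (dGammaAlgGraph_le_closure_core fun p hp => mem_closure_absK_testFunctions hp)
    (Submodule.isClosed_topologicalClosure _)

end

end HardyFock

end

/-! ### The theorem -/

theorem theorem3p2 (ρ : ℝ) (hρ : 0 < ρ) :
    HardyFock.gammaFin HardyFock.testFunctions ≤ (HardyFock.hardyOp ρ).domain ∧
    HardyFock.gammaFin HardyFock.testFunctions ≤ (HardyFock.dGamma HardyFock.absK).domain ∧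
    ∃ T : (HardyFock.dGamma HardyFock.absK).domain →ₗ[ℂ]
        HardyFock.Fock HardyFock.photonMeasure,
      HardyFock.IsBoundedExtension (HardyFock.dGamma HardyFock.absK) (HardyFock.hardyOp ρ)
        (HardyFock.gammaFin HardyFock.testFunctions) T ∧
      (∀ T', HardyFock.IsBoundedExtension (HardyFock.dGamma HardyFock.absK) (HardyFock.hardyOp ρ)
        (HardyFock.gammaFin HardyFock.testFunctions) T' → T' = T) ∧
      ∀ Φ : (HardyFock.dGamma HardyFock.absK).domain,
        ‖T Φ‖ ≤ 2 * ‖HardyFock.dGamma HardyFock.absK Φ‖ := by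
  have hdom := HardyFock.gammaFin_le_hardyOp_domain hρ
  have hbound := HardyFock.norm_hardyMap_le hρ
  -- Agreement holds on the whole intersection of the two domains, since both sides are given by the
  -- same formula in every sector.
  have hagree : ∀ (Φ : (HardyFock.dGamma HardyFock.absK).domain) (Ψ : (HardyFock.hardyOp ρ).domain),
      (Φ : HardyFock.Fock HardyFock.photonMeasure) = Ψ →
      HardyFock.hardyMap hρ Φ = HardyFock.hardyOp ρ Ψ := fun Φ Ψ h => by
    ext1; funext n
    rw [HardyFock.hardyMap_apply, HardyFock.hardyOp_apply hρ, h]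
  refine ⟨hdom, HardyFock.gammaFin_le_dGamma_domain HardyFock.testFunctions_le_absK_domain,
    HardyFock.hardyMap hρ, ⟨⟨2, fun Φ => ?_⟩, fun Φ Ψ h _ => hagree Φ Ψ h⟩, ?_, hbound⟩
  · exact (hbound Φ).trans (by linarith [norm_nonneg (Φ : HardyFock.Fock HardyFock.photonMeasure)])
  · rintro T' ⟨⟨C, hC⟩, hT'⟩
    -- The difference of two extensions is bounded for the graph norm and vanishes on the core of
    -- products of test functions.
    refine sub_eq_zero.1 (HardyFock.eq_zero_of_isBoundedOnDomain ⟨C + 2, fun Φ => ?_⟩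
      HardyFock.dGammaCore_le_dGamma_absK_graph HardyFock.dGamma_absK_graph_le_closure_core
      fun Φ h => ?_)
    · rw [LinearMap.sub_apply]
      refine (norm_sub_le _ _).trans ?_
      have h1 := hC Φ
      have h2 := hbound Φ
      have h3 := norm_nonneg (Φ : HardyFock.Fock HardyFock.photonMeasure)
      linarith
    · have hΦ := HardyFock.fst_mem_gammaFin_of_mem_core h
      rw [LinearMap.sub_apply, hT' Φ ⟨Φ, hdom hΦ⟩ rfl hΦ, hagree Φ ⟨Φ, hdom hΦ⟩ rfl, sub_self]
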